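/- **Notation.** For $\beta>0$ let $n$ be the integer with $n-1<\beta\le n$. The left Riemann–Liouville derivative of order $\beta$ of $u:\mathbb{R}\to\mathbb{C}$ is $${}_{-\infty}D_x^{\beta}u(x)=\frac{1}{\Gamma(n-\beta)}\frac{d^n}{dx^n}\int_{-\infty}^x (x-s)^{n-\beta-1}u(s)\,ds\quad(\beta<n),\qquad {}_{-\infty}D_x^{n}u=u^{(n)}\quad(\beta=n);$$ it is said to exist if the integral converges absolutely for every $x\in\mathbb{R}$ (when $\beta<n$) and is $n$ times differentiable on $\mathbb{R}$ (respectively, $u$ is $n$ times differentiable on $\mathbb{R}$ when $\beta=n$). For $h>0$ and $p\in\mathbb{R}$ let $$A^{\alpha}_{h,p}u(x)=\frac{1}{h^{\alpha}}\sum_{k=0}^{\infty}w_k^{(\alpha)}u(x-(k-p)h),\qquad w_k^{(\alpha)}=(-1)^k\binom{\alpha}{k}.$$ **Theorem.** Let $1<\alpha\le 2$ and $u\in L^1(\mathbb{R})$. Suppose that ${}_{-\infty}D_x^{\alpha+2}u$ exists and that it and its Fourier transform belong to $L^1(\mathbb{R})$. Let $m\ge 2$ be an integer and let $\lambda_1,\dots,\lambda_m,p_1,\dots,p_m$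 be real numbers with $$\sum_{j=1}^m\lambda_j=1,\qquad \sum_{j=1}^m\lambda_j\Big(p_j-\frac{\alpha}{2}\Big)=0.$$ Then ${}_{-\infty}D_x^{\alpha}u$ exists, and $$\sum_{j=1}^m\lambda_jA^{\alpha}_{h,p_j}u(x)={}_{-\infty}D_x^{\alpha}u(x)+O(h^2)\qquad (h\to0^+)$$ uniformly in $x$; that is, there are $C$ and $h_0>0$ such that for every $0<h<h_0$ the series $A^{\alpha}_{h,p_j}u(x)$ converge absolutely and $$\Big|\sum_{j=1}^m\lambda_jA^{\alpha}_{h,p_j}u(x)-{}_{-\infty}D_x^{\alpha}u(x)\Big|\le Ch^2$$ for almost every $x\in\mathbb{R}$, and for every $x\in\mathbb{R}$ if $u$ is continuous. -/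

import Mathlib

open MeasureTheory Set
open scoped FourierTransform

/-- The left Riemann–Liouville fractional integral of order `γ ≥ 0` with base point `-∞`,
`x ↦ 1/Γ(γ) ∫_{-∞}^x (x - s)^(γ - 1) u(s) ds`; for `γ = 0` it is the identity. -/
noncomputable def leftRLIntegral (γ : ℝ) (u : ℝ → ℂ) (x : ℝ) : ℂ :=
  if γ = 0 then u x
  else (1 / Real.Gamma γ) • ∫ s in Iio x, ((x - s) ^ (γ - 1)) • u s

/-- The left Riemann–Liouville derivative of order `β ≥ 0` with base point `-∞`,
`x ↦ 1/Γ(n - β) dⁿ/dxⁿ ∫_{-∞}^x (x - s)^(n - β - 1) u(s) ds`, where `n - 1 < β ≤ n`.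
For an integer `β = n` this is the ordinary `n`-th derivative. -/
noncomputable def leftRLDeriv (β : ℝ) (u : ℝ → ℂ) : ℝ → ℂ :=
  iteratedDeriv ⌈β⌉₊ (leftRLIntegral (⌈β⌉₊ - β) u)

/-- The left Riemann–Liouville derivative of order `β` of `u` exists at every point of `ℝ`: the
integral that defines the fractional integral of order `n - β` (`n - 1 < β ≤ n`) converges
absolutely at every point, and the fractional integral is `n` times differentiable on `ℝ`. -/
def LeftRLDifferentiable (β : ℝ) (u : ℝ → ℂ) : Prop :=
  ((⌈β⌉₊ : ℝ) - β ≠ 0 →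
      ∀ x : ℝ, IntegrableOn (fun s : ℝ => ((x - s) ^ ((⌈β⌉₊ : ℝ) - β - 1)) • u s) (Iio x)) ∧
    ∀ k < ⌈β⌉₊, Differentiable ℝ (iteratedDeriv k (leftRLIntegral (⌈β⌉₊ - β) u))

/-- The normalized Grünwald weights `w_k = (-1)^k (α choose k)`. -/
noncomputable def grunwaldWeight (α : ℝ) (k : ℕ) : ℝ :=
  (-1) ^ k * Ring.choose α k

/-- The left Grünwald difference operator with step `h` and shift `p`,
`A u(x) = h^(-α) ∑_{k ≥ 0} w_k u(x - (k - p) h)`. -/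
noncomputable def leftGrunwald (α h p : ℝ) (u : ℝ → ℂ) (x : ℝ) : ℂ :=
  (1 / h ^ α) • ∑' k : ℕ, grunwaldWeight α k • u (x - ((k : ℝ) - p) * h)

/-- The left weighted and shifted Grünwald difference operator `∑_j lam_j A_{h, p_j} u(x)`. -/
noncomputable def leftWSGD {m : ℕ} (α h : ℝ) (lam p : Fin m → ℝ) (u : ℝ → ℂ) (x : ℝ) : ℂ :=
  ∑ j, lam j • leftGrunwald α h (p j) u x

/-! ### Grünwald weights -/

/-! Write z = 2πiξ and γ = 2 - α ∈ [0, 1). On the Fourier side a shifted Grünwald operator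
multiplies by h^(-α) e^(pzh) (1 - e^(-zh))^α, and the derivative of order α by z^α. The quotient of
the weighted symbol by z^α is an analytic function of zh near 0, with value ∑ λ_j = 1 and derivative
∑ λ_j (p_j - α/2) = 0 there, so the two symbols differ by O(h² |z|^(α+2)) (`exists_symbol_bound`).
Once z^(α+2) 𝓕u is integrable, bounding an inverse Fourier integral by an L¹ norm gives the uniform
O(h²) (`norm_leftWSGD_fourierInv_sub_le`).

The work lies in tying the pointwise derivatives to these multipliers. The orders α and α + 2
involve the same fractional integral g of order γ, with derivatives g'' and g'''', but g need not be
integrable and so may lack a Fourier integral. Its backward differences have one: g(x) - g(x - h) is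
u convolved with an integrable difference of kernels, whose transform is a limit of Laplace
transforms (`hasFractionalIntegralDifferences_leftRLIntegral`).

Transforming the fourth difference of g in two ways gives 𝓕(g'''') = z^(α+2) 𝓕u for ξ ≠ 0
(`HasFractionalIntegralDifferences.fourier_iteratedDeriv`). Hence z^s 𝓕u is integrable for 0 ≤ s ≤ α
+ 2, and difference quotients of g yield g' and then g'' as inverse Fourier integrals
(`HasFractionalIntegralDifferences.iteratedDeriv_two_eq`). Fourier inversion recovers u almost
everywhere, or everywhere if u is continuous. -/

theorem grunwaldWeight_zero (α : ℝ) : grunwaldWeight α 0 = 1 := by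
  simp [grunwaldWeight]

theorem grunwaldWeight_succ (α : ℝ) (k : ℕ) :
    ((k : ℝ) + 1) * grunwaldWeight α (k + 1) = (k - α) * grunwaldWeight α k := by
  have h1 := Ring.descPochhammer_eq_factorial_smul_choose α k
  have h2 := Ring.descPochhammer_eq_factorial_smul_choose α (k + 1)
  rw [descPochhammer_succ_right, Polynomial.smeval_mul, h1] at h2
  simp only [Polynomial.smeval_sub, Polynomial.smeval_X, Polynomial.smeval_natCast, nsmul_eq_mul,
    Nat.factorial_succ, Nat.cast_mul, pow_one, pow_zero, mul_one, Nat.cast_add, Nat.cast_one] at h2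
  have h3 : (k.factorial : ℝ) ≠ 0 := by positivity
  have h4 : ((k : ℝ) + 1) * Ring.choose α (k + 1) = (α - k) * Ring.choose α k := by
    apply mul_left_cancel₀ h3
    linear_combination -h2
  unfold grunwaldWeight
  rw [pow_succ]
  linear_combination (-(-1) ^ k) * h4

/-- Pascal's rule telescopes; equivalently, dividing (1 - z)^(a+1) by 1 - z gives (1 - z)^a. -/
theorem sum_grunwaldWeight (a : ℝ) (n : ℕ) :
    ∑ k ∈ Finset.range (n + 1), grunwaldWeight (a + 1) k = grunwaldWeight a n := by
  induction n with
  | zero => simp [grunwaldWeight_zero]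
  | succ n ih =>
    rw [Finset.sum_range_succ, ih]
    simp only [grunwaldWeight, Ring.choose_succ_succ, pow_succ]
    ring

theorem abs_grunwaldWeight_le_one {a : ℝ} (h0 : 0 ≤ a) (h1 : a ≤ 1) (n : ℕ) :
    |grunwaldWeight a n| ≤ 1 := by
  induction n with
  | zero => simp [grunwaldWeight_zero]
  | succ n ih =>
    have h := congrArg abs (grunwaldWeight_succ a n)
    have hn : (0 : ℝ) ≤ n := n.cast_nonneg
    rw [abs_mul, abs_mul, abs_of_pos (by positivity : (0 : ℝ) < n + 1)] at h
    have h2 : |(n : ℝ) - a| ≤ n + 1 := by rw [abs_le]; constructor <;> linarith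
    have h3 : ((n : ℝ) + 1) * |grunwaldWeight a (n + 1)| ≤ (n + 1) * 1 := by
      rw [h]; exact mul_le_mul h2 ih (abs_nonneg _) (by positivity)
    exact le_of_mul_le_mul_left h3 (by positivity)

theorem grunwaldWeight_add_two_nonneg {α : ℝ} (h1 : 1 ≤ α) (h2 : α ≤ 2) (k : ℕ) :
    0 ≤ grunwaldWeight α (k + 2) := by
  induction k with
  | zero =>
    have e0 := grunwaldWeight_succ α 0
    have e1 := grunwaldWeight_succ α 1
    rw [grunwaldWeight_zero] at e0
    norm_num at e0 e1 ⊢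
    rw [e0] at e1
    nlinarith
  | succ k ih =>
    have e := grunwaldWeight_succ α (k + 2)
    have hk : (0 : ℝ) ≤ k := k.cast_nonneg
    push_cast at e
    have : 0 ≤ ((k : ℝ) + 2 + 1) * grunwaldWeight α (k + 2 + 1) := by
      rw [e]; exact mul_nonneg (by linarith) ih
    exact nonneg_of_mul_nonneg_right this (by positivity)

/-- From index 2 on the weights are nonnegative, so the sums of absolute values are plain partial
sums up to two terms. Those equal weights of order α - 1 ∈ [0, 1], which are bounded by 1. -/
theorem summable_abs_grunwaldWeight {α : ℝ} (h1 : 1 ≤ α) (h2 : α ≤ 2) :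
    Summable fun k => |grunwaldWeight α k| := by
  rw [← summable_nat_add_iff 2]
  apply summable_of_sum_range_le (c := 1 + |grunwaldWeight α 0| + |grunwaldWeight α 1|)
  · intro n; positivity
  · intro n
    have hn := sum_grunwaldWeight (α - 1) (n + 1)
    rw [sub_add_cancel, Finset.sum_range_succ', Finset.sum_range_succ'] at hn
    rw [Finset.sum_congr rfl fun k _ => abs_of_nonneg (grunwaldWeight_add_two_nonneg h1 h2 k)]
    have hb := (abs_le.1 (abs_grunwaldWeight_le_one (a := α - 1) (by linarith) (by linarith)
      (n + 1))).2
    have := neg_abs_le (grunwaldWeight α 0)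
    have := neg_abs_le (grunwaldWeight α 1)
    simp only [zero_add] at hn
    linarith

/-- The binomial series converges to its sum on the closed unit disc. -/
theorem hasSum_grunwaldWeight {α : ℝ} (h1 : 1 ≤ α) (h2 : α ≤ 2) {z : ℂ} (hz : ‖z‖ ≤ 1) :
    HasSum (fun k => (grunwaldWeight α k : ℂ) * z ^ k) ((1 - z) ^ (α : ℂ)) := by
  have hs := summable_abs_grunwaldWeight h1 h2
  have hbound : ∀ (k : ℕ) (y : ℂ), y ∈ Metric.closedBall (0 : ℂ) 1 →
      ‖(grunwaldWeight α k : ℂ) * y ^ k‖ ≤ |grunwaldWeight α k| := by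
    intro k y hy
    rw [norm_mul, norm_pow, Complex.norm_real, Real.norm_eq_abs]
    exact mul_le_of_le_one_right (abs_nonneg _)
      (pow_le_one₀ (norm_nonneg _) (by simpa using hy))
  have hsum : Summable fun k => (grunwaldWeight α k : ℂ) * z ^ k :=
    Summable.of_norm_bounded hs fun k => hbound k z (by simpa using hz)
  have hopen : ∀ y : ℂ, ‖y‖ < 1 →
      ∑' k, (grunwaldWeight α k : ℂ) * y ^ k = (1 - y) ^ (α : ℂ) := by
    intro y hy
    have := (Complex.one_add_cpow_hasFPowerSeriesOnBall_zero (a := (α : ℂ))).hasSum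
      (y := -y) (by
        rw [Metric.mem_eball, edist_zero_right, enorm_neg, ← ofReal_norm]
        exact ENNReal.ofReal_lt_one.2 hy)
    simp only [binomialSeries_apply, List.ofFn_const, List.prod_replicate, zero_add,
      smul_eq_mul] at this
    rw [sub_eq_add_neg, ← this.tsum_eq]
    refine tsum_congr fun k => ?_
    rw [neg_pow, grunwaldWeight]
    push_cast [Complex.ofReal_choose]
    ring
  have hcont : ContinuousOn (fun y : ℂ => ∑' k, (grunwaldWeight α k : ℂ) * y ^ k)
      (Metric.closedBall 0 1) :=
    continuousOn_tsum (fun k => by fun_prop) hs hbound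
  -- Abel's argument: the identity holds at rz for r < 1, and both sides are continuous as r → 1
  -- from below.
  have hpath : Filter.Tendsto (fun r : ℝ => (r : ℂ) * z) (nhdsWithin 1 (Ico 0 1))
      (nhdsWithin z (Metric.closedBall 0 1)) := by
    apply tendsto_nhdsWithin_of_tendsto_nhds_of_eventually_within
    · have : Continuous fun r : ℝ => (r : ℂ) * z := by fun_prop
      simpa using (this.tendsto 1).mono_left nhdsWithin_le_nhds
    · filter_upwards [self_mem_nhdsWithin] with r hr
      simp only [Metric.mem_closedBall, dist_zero_right, norm_mul, Complex.norm_real,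
        Real.norm_eq_abs, abs_of_nonneg hr.1]
      exact mul_le_one₀ hr.2.le (norm_nonneg _) hz
  have hL := (hcont z (by simpa using hz)).tendsto.comp hpath
  have hre : 0 ≤ (1 - z).re := by
    have := (Complex.re_le_norm z).trans hz
    simpa using this
  -- The case z = 1 is included: the power is continuous at base 0 because its exponent has positive
  -- real part.
  have hR : Filter.Tendsto (fun r : ℝ => (1 - (r : ℂ) * z) ^ (α : ℂ)) (nhdsWithin 1 (Ico 0 1))
      (nhds ((1 - z) ^ (α : ℂ))) := by
    have hc : ContinuousAt (fun y : ℂ => (1 - y) ^ (α : ℂ)) z :=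
      ContinuousAt.comp (f := fun y : ℂ => 1 - y)
        (Complex.continuousAt_cpow_const_of_re_pos (Or.inl hre) (by simp; linarith)) (by fun_prop)
    exact hc.tendsto.comp (hpath.mono_right nhdsWithin_le_nhds)
  have hne : (nhdsWithin (1 : ℝ) (Ico 0 1)).NeBot := by
    rw [← mem_closure_iff_nhdsWithin_neBot, closure_Ico (by norm_num)]
    simp
  have := tendsto_nhds_unique hL (hR.congr' (by
    filter_upwards [self_mem_nhdsWithin] with r hr
    refine (hopen _ ?_).symm
    rw [norm_mul, Complex.norm_real, Real.norm_eq_abs, abs_of_nonneg hr.1]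
    exact (mul_le_of_le_one_right hr.1 hz).trans_lt hr.2))
  rw [← this]
  exact hsum.hasSum

/-! ### Symbol of the weighted and shifted difference -/

/-- The entire function `(1 - e⁻ᶻ) / z`. -/
noncomputable def expQuot (z : ℂ) : ℂ := dslope (fun z : ℂ => 1 - Complex.exp (-z)) 0 z

theorem mul_expQuot (z : ℂ) : z * expQuot z = 1 - Complex.exp (-z) := by
  have := sub_smul_dslope (fun z : ℂ => 1 - Complex.exp (-z)) 0 z
  simpa [expQuot] using this

theorem expQuot_zero : expQuot 0 = 1 := by
  have : HasDerivAt (fun z : ℂ => 1 - Complex.exp (-z)) 1 0 := by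
    simpa using ((hasDerivAt_neg (0 : ℂ)).cexp).const_sub 1
  rw [expQuot, dslope_same, this.deriv]

theorem analyticAt_expQuot : AnalyticAt ℂ expQuot 0 := by
  have : DifferentiableOn ℂ expQuot univ := by
    apply (Complex.differentiableOn_dslope Filter.univ_mem).2
    fun_prop
  exact this.analyticAt Filter.univ_mem

/-- Comes from (1 - e⁻ᶻ)/z = 1 - z/2 + O(z²); this 1/2 is the origin of the shift α/2 in the
condition on the p_j. -/
theorem hasDerivAt_expQuot : HasDerivAt expQuot (-1 / 2) 0 := by
  rw [hasDerivAt_iff_isLittleO]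
  have hO : (fun z : ℂ => expQuot z - expQuot 0 - (z - 0) • (-1 / 2 : ℂ)) =O[nhds 0]
      fun z : ℂ => z ^ 2 := by
    apply Asymptotics.IsBigO.of_bound 1
    filter_upwards [Metric.closedBall_mem_nhds (0 : ℂ) one_pos] with z hz
    rcases eq_or_ne z 0 with rfl | hz0
    · simp
    have hb := Complex.exp_bound (x := -z) (by simpa using hz) (n := 3) (by norm_num)
    have e : expQuot z - expQuot 0 - (z - 0) • (-1 / 2 : ℂ) =
        -(Complex.exp (-z) - ∑ m ∈ Finset.range 3, (-z) ^ m / m.factorial) / z := by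
      rw [eq_div_iff hz0, expQuot_zero]
      simp [Finset.sum_range_succ, Nat.factorial]
      linear_combination mul_expQuot z
    rw [e, norm_div, norm_neg, div_le_iff₀ (norm_pos_iff.2 hz0)]
    refine hb.trans ?_
    rw [norm_neg, norm_pow]
    norm_num [Nat.factorial]
    have := norm_nonneg z
    nlinarith [pow_nonneg this 3]
  refine hO.trans_isLittleO ?_
  simpa using Asymptotics.isLittleO_pow_id (𝕜 := ℂ) (n := 2) (by norm_num)

theorem AnalyticAt.isBigO_sub_sq {F : ℂ → ℂ} (hF : AnalyticAt ℂ F 0) (h : HasDerivAt F 0 0) :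
    (fun z => F z - F 0) =O[nhds 0] fun z => ‖z‖ ^ 2 := by
  obtain ⟨p, hp⟩ := hF
  have h1 := hp.isBigO_sub_partialSum_pow 2
  refine h1.congr_left fun y => ?_
  have hd : p.coeff 1 = 0 := by
    have := hp.hasDerivAt.unique h
    exact this
  have hc : p 0 (fun _ => y) = F 0 := hp.coeff_zero _
  rw [FormalMultilinearSeries.partialSum, Finset.sum_range_succ, Finset.sum_range_one, hc, zero_add]
  have : p 1 (fun _ => y) = 0 := by
    rw [FormalMultilinearSeries.apply_eq_pow_smul_coeff, hd, smul_zero]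
  rw [this, add_zero]

/-- The arguments lie in [-π/2, π/2] and (-π/2, π/2), so their sum stays inside (-π, π) and the
logarithm is additive. -/
theorem Complex.mul_cpow_of_re_pos {z w : ℂ} (hz : z ≠ 0) (hzr : 0 ≤ z.re) (hw : 0 < w.re)
    (a : ℂ) : (z * w) ^ a = z ^ a * w ^ a := by
  have hw0 : w ≠ 0 := by rintro rfl; simp at hw
  have h1 := Complex.abs_arg_le_pi_div_two_iff.2 hzr
  have h2 := Complex.abs_arg_lt_pi_div_two_iff.2 (Or.inl hw)
  rw [abs_le] at h1
  rw [abs_lt] at h2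
  rw [Complex.cpow_def_of_ne_zero (mul_ne_zero hz hw0), Complex.cpow_def_of_ne_zero hz,
    Complex.cpow_def_of_ne_zero hw0, ← Complex.exp_add, Complex.log_mul hz hw0
      ⟨by linarith, by linarith⟩, add_mul]

/-- The symbol of the weighted shifted Grünwald difference is second order accurate on the
imaginary axis. -/
theorem exists_symbol_bound {α : ℝ} (hα : 0 < α) {m : ℕ} (lam p : Fin m → ℝ)
    (hlam : ∑ j, lam j = 1) (hlamp : ∑ j, lam j * (p j - α / 2) = 0) :
    ∃ C : ℝ, 0 ≤ C ∧ ∀ y : ℝ,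
      ‖∑ j, (lam j : ℂ) * (Complex.exp (p j * (y * Complex.I)) *
          (1 - Complex.exp (-(y * Complex.I))) ^ (α : ℂ)) - (y * Complex.I) ^ (α : ℂ)‖
        ≤ C * |y| ^ (α + 2) := by
  -- The weighted symbol divided by z^α; the two conditions on the weights say F(0) = 1 and F'(0) =
  -- 0.
  set F : ℂ → ℂ := fun z => ∑ j, (lam j : ℂ) * (Complex.exp (p j * z) * expQuot z ^ (α : ℂ))
    with hFdef
  have hslit : expQuot 0 ∈ Complex.slitPlane := by simp [expQuot_zero]
  have hF0 : F 0 = 1 := by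
    simp only [hFdef, mul_zero, Complex.exp_zero, expQuot_zero, Complex.one_cpow, mul_one]
    exact_mod_cast hlam
  have hFan : AnalyticAt ℂ F 0 := by
    apply Finset.analyticAt_fun_sum
    intro j _
    have : AnalyticAt ℂ (fun z => expQuot z ^ (α : ℂ)) 0 :=
      analyticAt_expQuot.cpow analyticAt_const hslit
    fun_prop
  have hFd : HasDerivAt F 0 0 := by
    have : HasDerivAt F (∑ j, (lam j : ℂ) * (p j - α / 2)) 0 := by
      apply HasDerivAt.fun_sum
      intro j _
      apply HasDerivAt.const_mul
      have h1 : HasDerivAt (fun z : ℂ => Complex.exp (p j * z)) (p j) 0 := by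
        simpa using ((hasDerivAt_id (0 : ℂ)).const_mul (p j : ℂ)).cexp
      have h2 : HasDerivAt (fun z => expQuot z ^ (α : ℂ)) (-α / 2) 0 := by
        have := hasDerivAt_expQuot.cpow_const (c := (α : ℂ)) hslit
        rw [expQuot_zero, Complex.one_cpow] at this
        convert this using 1
        ring
      refine (h1.mul h2).congr_deriv ?_
      simp only [mul_zero, Complex.exp_zero, expQuot_zero, Complex.one_cpow, mul_one, one_mul]
      ring
    convert this using 1
    exact_mod_cast hlamp.symm
  obtain ⟨C₁, hC₁pos, hC₁⟩ := (hFan.isBigO_sub_sq hFd).exists_pos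
  have hre : ∀ᶠ z in nhds (0 : ℂ), 0 < (expQuot z).re := by
    have : ContinuousAt (fun z => (expQuot z).re) 0 :=
      Complex.continuous_re.continuousAt.comp analyticAt_expQuot.continuousAt
    exact this.eventually (lt_mem_nhds (by simp [expQuot_zero]))
  obtain ⟨δ, hδ, hball⟩ := Metric.eventually_nhds_iff_ball.1 (hC₁.bound.and hre)
  -- For |y| ≥ δ no cancellation is needed: the symbols are at most (∑ |λ_j|) 2^α and |y|^α, and
  -- (|y|/δ)^(α+2) and (|y|/δ)² are at least 1.
  set C₂ : ℝ := (∑ j, |lam j|) * 2 ^ α / δ ^ (α + 2) + 1 / δ ^ 2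
  have hC₂ : 0 ≤ C₂ := by positivity
  refine ⟨C₁ + C₂, by positivity, fun y => ?_⟩
  rcases eq_or_ne y 0 with rfl | hy
  · simp [Real.zero_rpow (by linarith : α + 2 ≠ 0), Complex.zero_cpow
      (Complex.ofReal_ne_zero.2 hα.ne')]
  have hypos : 0 < |y| := abs_pos.2 hy
  set z : ℂ := y * Complex.I with hz
  have hznorm : ‖z‖ = |y| := by simp [hz]
  have hz0 : z ≠ 0 := by rw [← norm_pos_iff, hznorm]; exact hypos
  have hpow : |y| ^ (α + 2) = |y| ^ α * |y| ^ 2 := by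
    rw [Real.rpow_add hypos]; norm_cast
  rcases lt_or_ge |y| δ with hlt | hge
  · obtain ⟨hb, hr⟩ := hball z (by simpa [hznorm] using hlt)
    have e : ∑ j, (lam j : ℂ) * (Complex.exp (p j * z) * (1 - Complex.exp (-z)) ^ (α : ℂ))
        - z ^ (α : ℂ) = z ^ (α : ℂ) * (F z - F 0) := by
      rw [← mul_expQuot, Complex.mul_cpow_of_re_pos hz0 (by simp [hz]) hr, hF0, mul_sub, mul_one,
        hFdef, Finset.mul_sum]
      congr 1
      exact Finset.sum_congr rfl fun j _ => by ring
    rw [e, norm_mul, Complex.norm_cpow_real, hznorm, hpow]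
    rw [norm_pow, norm_norm, hznorm] at hb
    have : |y| ^ α * ‖F z - F 0‖ ≤ |y| ^ α * (C₁ * |y| ^ 2) := by gcongr
    have h3 : 0 ≤ C₂ * (|y| ^ α * |y| ^ 2) := by positivity
    nlinarith
  · have h1 : ‖1 - Complex.exp (-z)‖ ≤ 2 := by
      refine (norm_sub_le _ _).trans ?_
      have : -z = ((-y : ℝ) : ℂ) * Complex.I := by simp [hz]
      rw [this, Complex.norm_exp_ofReal_mul_I]
      norm_num
    have h2 : ‖∑ j, (lam j : ℂ) * (Complex.exp (p j * z) * (1 - Complex.exp (-z)) ^ (α : ℂ))‖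
        ≤ (∑ j, |lam j|) * 2 ^ α := by
      rw [Finset.sum_mul]
      refine norm_sum_le_of_le _ fun j _ => ?_
      have : (p j : ℂ) * z = ((p j * y : ℝ) : ℂ) * Complex.I := by simp [hz, mul_assoc]
      rw [norm_mul, norm_mul, this, Complex.norm_exp_ofReal_mul_I, one_mul, Complex.norm_real,
        Real.norm_eq_abs, Complex.norm_cpow_real]
      gcongr
    have h3 : (1 : ℝ) ≤ |y| ^ (α + 2) / δ ^ (α + 2) := by
      rw [one_le_div (by positivity)]
      exact Real.rpow_le_rpow hδ.le hge (by linarith)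
    have h4 : (1 : ℝ) ≤ |y| ^ 2 / δ ^ 2 := by
      rw [one_le_div (by positivity)]
      gcongr
    refine (norm_sub_le _ _).trans ?_
    rw [Complex.norm_cpow_real, hznorm]
    have h5 : (∑ j, |lam j|) * 2 ^ α ≤
        (∑ j, |lam j|) * 2 ^ α * (|y| ^ (α + 2) / δ ^ (α + 2)) :=
      le_mul_of_one_le_right (by positivity) h3
    have h6 : |y| ^ α ≤ |y| ^ α * (|y| ^ 2 / δ ^ 2) :=
      le_mul_of_one_le_right (by positivity) h4
    have h7 : 0 ≤ C₁ * |y| ^ (α + 2) := by positivity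
    calc _ ≤ (∑ j, |lam j|) * 2 ^ α * (|y| ^ (α + 2) / δ ^ (α + 2)) +
          |y| ^ α * (|y| ^ 2 / δ ^ 2) := add_le_add (h2.trans h5) h6
      _ = C₂ * |y| ^ (α + 2) := by simp only [C₂, hpow]; ring
      _ ≤ _ := by linarith

/-! ### Fourier transforms and backward differences -/

/-- The Fourier multiplier `2πiξ` of the derivative. -/
noncomputable def derivSymbol (ξ : ℝ) : ℂ := ((2 * Real.pi * ξ : ℝ) : ℂ) * Complex.I

/-- The backward difference `x ↦ f x - f (x - h)`. -/
def backwardDiff (h : ℝ) (f : ℝ → ℂ) (x : ℝ) : ℂ := f x - f (x - h)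

theorem derivSymbol_ne_zero {ξ : ℝ} (hξ : ξ ≠ 0) : derivSymbol ξ ≠ 0 := by
  simp [derivSymbol, Real.pi_ne_zero, hξ]

theorem continuous_derivSymbol : Continuous derivSymbol := by
  unfold derivSymbol; fun_prop

theorem norm_derivSymbol (ξ : ℝ) : ‖derivSymbol ξ‖ = |2 * Real.pi * ξ| := by
  simp [derivSymbol]

theorem measurable_derivSymbol_cpow (s : ℂ) : Measurable fun ξ => derivSymbol ξ ^ s :=
  continuous_derivSymbol.measurable.pow_const s

theorem norm_exp_derivSymbol_mul (ξ a : ℝ) : ‖Complex.exp (derivSymbol ξ * a)‖ = 1 := by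
  have : derivSymbol ξ * a = ((2 * Real.pi * ξ * a : ℝ) : ℂ) * Complex.I := by
    simp [derivSymbol]; ring
  rw [this, Complex.norm_exp_ofReal_mul_I]

theorem norm_one_sub_exp_neg_derivSymbol_le (ξ h : ℝ) :
    ‖1 - Complex.exp (-(derivSymbol ξ * h))‖ ≤ ‖derivSymbol ξ‖ * |h| := by
  have := Real.norm_exp_I_mul_ofReal_sub_one_le (x := -(2 * Real.pi * ξ * h))
  rw [norm_sub_rev, norm_derivSymbol, ← abs_mul, ← abs_neg, ← Real.norm_eq_abs]
  have e : -(derivSymbol ξ * h) = Complex.I * ((-(2 * Real.pi * ξ * h) : ℝ) : ℂ) := by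
    simp [derivSymbol]; ring
  rwa [e]

theorem fourier_eq_integral_derivSymbol (f : ℝ → ℂ) (ξ : ℝ) :
    𝓕 f ξ = ∫ x : ℝ, Complex.exp (-(derivSymbol ξ * x)) * f x := by
  rw [Real.fourier_real_eq_integral_exp_smul]
  refine integral_congr_ae (.of_forall fun x => ?_)
  simp only [smul_eq_mul]
  congr 2
  simp [derivSymbol]; ring

theorem fourierInv_eq_integral_derivSymbol (f : ℝ → ℂ) (x : ℝ) :
    𝓕⁻ f x = ∫ ξ : ℝ, Complex.exp (derivSymbol ξ * x) * f ξ := by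
  rw [Real.fourierInv_eq']
  refine integral_congr_ae (.of_forall fun ξ => ?_)
  simp only [smul_eq_mul]
  congr 2
  simp [derivSymbol]; ring

theorem continuous_fourier {f : ℝ → ℂ} (hf : Integrable f) : Continuous (𝓕 f) :=
  VectorFourier.fourierIntegral_continuous Real.continuous_fourierChar
    (by exact continuous_inner) hf

theorem continuous_fourierInv {f : ℝ → ℂ} (hf : Integrable f) : Continuous (𝓕⁻ f) := by
  have : 𝓕⁻ f = fun x => 𝓕 f (-x) := by
    ext x; exact Real.fourierInv_eq_fourier_neg f x
  rw [this]
  exact (continuous_fourier hf).comp continuous_neg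

theorem norm_fourierInv_le (f : ℝ → ℂ) (x : ℝ) : ‖𝓕⁻ f x‖ ≤ ∫ ξ, ‖f ξ‖ := by
  rw [fourierInv_eq_integral_derivSymbol]
  refine (norm_integral_le_integral_norm _).trans_eq ?_
  simp [norm_exp_derivSymbol_mul]

theorem fourier_comp_sub_right (f : ℝ → ℂ) (a ξ : ℝ) :
    𝓕 (fun x => f (x - a)) ξ = Complex.exp (-(derivSymbol ξ * a)) * 𝓕 f ξ := by
  rw [fourier_eq_integral_derivSymbol, fourier_eq_integral_derivSymbol, ← integral_const_mul,
    ← integral_sub_right_eq_self (fun x : ℝ => Complex.exp (-(derivSymbol ξ * a)) *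
      (Complex.exp (-(derivSymbol ξ * x)) * f x)) a]
  refine integral_congr_ae (.of_forall fun x => ?_)
  simp only [← mul_assoc, ← Complex.exp_add]
  congr 2
  push_cast
  ring

theorem integrable_exp_derivSymbol_mul {f : ℝ → ℂ} (hf : Integrable f) (x : ℝ) :
    Integrable fun ξ : ℝ => Complex.exp (derivSymbol ξ * x) * f ξ := by
  apply hf.bdd_mul (c := 1)
  · exact (Complex.continuous_exp.comp (continuous_derivSymbol.mul
      continuous_const)).aestronglyMeasurable
  · exact .of_forall fun ξ => (norm_exp_derivSymbol_mul ξ x).le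

theorem integrable_exp_neg_derivSymbol_mul {f : ℝ → ℂ} (hf : Integrable f) (ξ : ℝ) :
    Integrable fun x : ℝ => Complex.exp (-(derivSymbol ξ * x)) * f x := by
  apply hf.bdd_mul (c := 1)
  · exact Continuous.aestronglyMeasurable (by fun_prop)
  · exact .of_forall fun x => by
      have := norm_exp_derivSymbol_mul ξ (-x)
      push_cast at this
      rw [mul_neg] at this
      exact this.le

theorem fourier_sub {f g : ℝ → ℂ} (hf : Integrable f) (hg : Integrable g) (ξ : ℝ) :
    𝓕 (fun x => f x - g x) ξ = 𝓕 f ξ - 𝓕 g ξ := by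
  simp only [fourier_eq_integral_derivSymbol, mul_sub]
  exact integral_sub (integrable_exp_neg_derivSymbol_mul hf ξ)
    (integrable_exp_neg_derivSymbol_mul hg ξ)

/-! ### Backward differences under the Fourier transform -/

theorem MeasureTheory.Integrable.backwardDiff {f : ℝ → ℂ} (hf : Integrable f) (h : ℝ) :
    Integrable (backwardDiff h f) :=
  hf.sub (hf.comp_sub_right h)

theorem fourier_backwardDiff {f : ℝ → ℂ} (hf : Integrable f) (h ξ : ℝ) :
    𝓕 (backwardDiff h f) ξ = (1 - Complex.exp (-(derivSymbol ξ * h))) * 𝓕 f ξ := by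
  have : backwardDiff h f = fun x => f x - f (x - h) := rfl
  rw [this, fourier_sub hf (hf.comp_sub_right h), fourier_comp_sub_right]
  ring

theorem Differentiable.backwardDiff {f : ℝ → ℂ} (hf : Differentiable ℝ f) (h : ℝ) :
    Differentiable ℝ (backwardDiff h f) := by
  unfold _root_.backwardDiff; fun_prop

theorem deriv_backwardDiff {f : ℝ → ℂ} (hf : Differentiable ℝ f) (h : ℝ) :
    deriv (backwardDiff h f) = backwardDiff h (deriv f) := by
  ext x
  have h1 : HasDerivAt (fun x => f (x - h)) (deriv f (x - h)) x := by
    simpa using (hf (x - h)).hasDerivAt.comp_sub_const x h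
  exact ((hf x).hasDerivAt.sub h1).deriv

/-- The backward difference of a function with integrable derivative is a convolution of
the derivative with an indicator function, hence integrable. -/
theorem integrable_backwardDiff_of_deriv {f : ℝ → ℂ} (hf : Differentiable ℝ f)
    (hf' : Integrable (deriv f)) {h : ℝ} (hh : 0 ≤ h) : Integrable (backwardDiff h f) := by
  have hi : Integrable (indicator (Ioc 0 h) fun _ : ℝ => (1 : ℂ)) :=
    (integrable_indicator_iff measurableSet_Ioc).2 (by simp)
  have hc := hi.integrable_convolution (ContinuousLinearMap.mul ℂ ℂ) hf'
  refine hc.congr (.of_forall fun x => ?_)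
  have e : ∀ t, (ContinuousLinearMap.mul ℂ ℂ) (indicator (Ioc 0 h) (fun _ : ℝ => (1 : ℂ)) t)
      (deriv f (x - t)) = indicator (Ioc 0 h) (fun t => deriv f (x - t)) t := by
    intro t
    by_cases ht : t ∈ Ioc 0 h <;> simp [ht]
  simp only [MeasureTheory.convolution, e]
  rw [integral_indicator measurableSet_Ioc, ← intervalIntegral.integral_of_le hh,
    intervalIntegral.integral_comp_sub_left (fun t => deriv f t), sub_zero,
    intervalIntegral.integral_eq_sub_of_hasDerivAt (fun t _ => (hf t).hasDerivAt)
      hf'.intervalIntegrable]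
  rfl

/-- Replaces the rule for the transform of a derivative when f itself is not integrable:
differencing commutes with differentiation and restores integrability. -/
theorem derivSymbol_mul_fourier_backwardDiff {f : ℝ → ℂ} (hf : Differentiable ℝ f)
    (hf' : Integrable (deriv f)) {h : ℝ} (hh : 0 ≤ h) (ξ : ℝ) :
    derivSymbol ξ * 𝓕 (backwardDiff h f) ξ =
      (1 - Complex.exp (-(derivSymbol ξ * h))) * 𝓕 (deriv f) ξ := by
  have hd := deriv_backwardDiff hf h
  have := congrFun (Real.fourier_deriv (integrable_backwardDiff_of_deriv hf hf' hh)
    (hf.backwardDiff h) (by rw [hd]; exact hf'.backwardDiff h)) ξ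
  rw [hd, fourier_backwardDiff hf'] at this
  rw [this, smul_eq_mul]
  congr 1
  simp [derivSymbol]; ring

theorem differentiable_iterate_backwardDiff {f : ℝ → ℂ} (hf : Differentiable ℝ f) (h : ℝ)
    (k : ℕ) : Differentiable ℝ ((backwardDiff h)^[k] f) ∧
      deriv ((backwardDiff h)^[k] f) = (backwardDiff h)^[k] (deriv f) := by
  induction k with
  | zero => exact ⟨hf, rfl⟩
  | succ k ih =>
    rw [Function.iterate_succ_apply', Function.iterate_succ_apply']
    exact ⟨ih.1.backwardDiff h, by rw [deriv_backwardDiff ih.1, ih.2]⟩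

theorem fourier_iterate_backwardDiff {f : ℝ → ℂ} (hf : Integrable f) (h ξ : ℝ) (k : ℕ) :
    Integrable ((backwardDiff h)^[k] f) ∧ 𝓕 ((backwardDiff h)^[k] f) ξ =
      (1 - Complex.exp (-(derivSymbol ξ * h))) ^ k * 𝓕 f ξ := by
  induction k with
  | zero => simpa using hf
  | succ k ih =>
    rw [Function.iterate_succ_apply']
    refine ⟨ih.1.backwardDiff h, ?_⟩
    rw [fourier_backwardDiff ih.1, ih.2, pow_succ]
    ring

/-- Each difference pays for one derivative, so only the top derivative has to be integrable. -/
theorem derivSymbol_pow_mul_fourier_iterate_backwardDiff {h : ℝ} (hh : 0 ≤ h) (ξ : ℝ) (k : ℕ)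
    {f : ℝ → ℂ} (hf : ∀ j < k, Differentiable ℝ (iteratedDeriv j f))
    (hfk : Integrable (iteratedDeriv k f)) :
    Integrable ((backwardDiff h)^[k] f) ∧
      derivSymbol ξ ^ k * 𝓕 ((backwardDiff h)^[k] f) ξ =
        (1 - Complex.exp (-(derivSymbol ξ * h))) ^ k * 𝓕 (iteratedDeriv k f) ξ := by
  induction k generalizing f with
  | zero => simpa using hfk
  | succ k ih =>
    have hd : Differentiable ℝ f := by simpa using hf 0 (Nat.succ_pos k)
    rw [iteratedDeriv_succ'] at hfk ⊢
    obtain ⟨h1, h2⟩ := ih (f := deriv f) (fun j hj => by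
      rw [← iteratedDeriv_succ']; exact hf (j + 1) (Nat.succ_lt_succ hj)) hfk
    obtain ⟨h3, h4⟩ := differentiable_iterate_backwardDiff hd h k
    rw [Function.iterate_succ_apply']
    refine ⟨integrable_backwardDiff_of_deriv h3 (by rwa [h4]) hh, ?_⟩
    have h5 := derivSymbol_mul_fourier_backwardDiff h3 (by rwa [h4]) hh ξ
    rw [h4] at h5
    rw [pow_succ, mul_assoc, h5, pow_succ]
    linear_combination (1 - Complex.exp (-(derivSymbol ξ * h))) * h2

/-! ### Differentiation of inverse Fourier integrals, and inversion almost everywhere -/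

theorem hasDerivAt_fourierInv {f : ℝ → ℂ} (hf : Integrable f)
    (hf' : Integrable fun ξ => derivSymbol ξ * f ξ) (x : ℝ) :
    HasDerivAt (𝓕⁻ f) (𝓕⁻ (fun ξ => derivSymbol ξ * f ξ) x) x := by
  have hx : Integrable fun ξ : ℝ => ξ • f ξ := by
    refine (hf'.const_mul (1 / (2 * Real.pi * Complex.I))).congr (.of_forall fun ξ => ?_)
    have : (Real.pi : ℂ) ≠ 0 := by simp [Real.pi_ne_zero]
    simp only [derivSymbol, Complex.real_smul]
    push_cast
    field_simp
  have h1 := Real.hasDerivAt_fourier hf hx (-x)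
  have h2 := h1.scomp x (hasDerivAt_neg x)
  have e : 𝓕⁻ f = 𝓕 f ∘ Neg.neg := by
    ext y; exact Real.fourierInv_eq_fourier_neg f y
  rw [e]
  refine h2.congr_deriv ?_
  rw [Real.fourierInv_eq_fourier_neg, fourier_eq_integral_derivSymbol,
    fourier_eq_integral_derivSymbol, neg_smul, one_smul, ← integral_neg]
  refine integral_congr_ae (.of_forall fun ξ => ?_)
  have e : derivSymbol ξ = 2 * Real.pi * Complex.I * ξ := by
    rw [derivSymbol]; push_cast; ring
  simp only [e, smul_eq_mul]
  ring

/-- Fourier inversion almost everywhere, without continuity. -/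
theorem MeasureTheory.Integrable.fourierInv_fourier_ae_eq {f : ℝ → ℂ} (hf : Integrable f)
    (hf' : Integrable (𝓕 f)) : 𝓕⁻ (𝓕 f) =ᵐ[volume] f := by
  -- By duality: both transforms are moved onto a smooth compactly supported test function, a
  -- Schwartz function, for which inversion is known.
  apply ae_eq_of_integral_contDiff_smul_eq
    (continuous_fourierInv hf').locallyIntegrable hf.locallyIntegrable
  intro g hg hgc
  have hgc' : HasCompactSupport fun x => (g x : ℂ) := hgc.comp_left Complex.ofReal_zero
  have hgd : ContDiff ℝ (⊤ : ℕ∞) fun x => (g x : ℂ) := Complex.ofRealCLM.contDiff.comp hg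
  set φ : SchwartzMap ℝ ℂ := hgc'.toSchwartzMap hgd with hφ
  have hφ' : ∀ x, φ x = g x := fun x => rfl
  have hψ : ∀ x, 𝓕 (𝓕⁻ (φ : ℝ → ℂ)) x = φ x := by
    intro x
    rw [← SchwartzMap.fourierInv_coe, ← SchwartzMap.fourier_coe,
      FourierTransform.fourier_fourierInv_eq]
  have hint : Integrable (𝓕⁻ (φ : ℝ → ℂ)) := by
    rw [← SchwartzMap.fourierInv_coe]
    exact (𝓕⁻ φ).integrable
  have flip : ∀ {a b : ℝ → ℂ}, Integrable a → Integrable b →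
      ∫ ξ, 𝓕 a ξ * b ξ = ∫ x, a x * 𝓕 b x := by
    intro a b ha hb
    have := VectorFourier.integral_fourierIntegral_smul_eq_flip (μ := volume) (ν := volume)
      (L := innerₗ ℝ) Real.continuous_fourierChar (by exact continuous_inner) ha hb
    simp only [flip_innerₗ] at this
    exact this
  calc ∫ x, g x • 𝓕⁻ (𝓕 f) x = ∫ x, 𝓕 (fun ξ => 𝓕 f (-ξ)) x * φ x := by
        refine integral_congr_ae (.of_forall fun x => ?_)
        simp only [hφ', Complex.real_smul]
        rw [Real.fourierInv_eq_fourier_comp_neg, mul_comm]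
    _ = ∫ ξ, 𝓕 f (-ξ) * 𝓕 φ ξ := flip hf'.comp_neg φ.integrable
    _ = ∫ ξ, 𝓕 f ξ * 𝓕 φ (-ξ) := by
        rw [← integral_neg_eq_self]
        simp
    _ = ∫ ξ, 𝓕 f ξ * 𝓕⁻ (φ : ℝ → ℂ) ξ := by
        simp only [Real.fourierInv_eq_fourier_neg, SchwartzMap.fourier_coe]
    _ = ∫ x, f x * 𝓕 (𝓕⁻ (φ : ℝ → ℂ)) x := flip hf hint
    _ = ∫ x, g x • f x := by
        refine integral_congr_ae (.of_forall fun x => ?_)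
        simp only [hψ, hφ', Complex.real_smul, mul_comm]

/-! ### Derivatives of a fractional integral as inverse Fourier integrals -/

/-- The backward differences of `g` are integrable, and their Fourier transforms are those of the
backward differences of a fractional integral of order `γ` of `u`. -/
def HasFractionalIntegralDifferences (γ : ℝ) (u g : ℝ → ℂ) : Prop :=
  ∀ h : ℝ, 0 < h → Integrable (backwardDiff h g) ∧ ∀ ξ : ℝ, ξ ≠ 0 →
    𝓕 (backwardDiff h g) ξ =
      (1 - Complex.exp (-(derivSymbol ξ * h))) * (derivSymbol ξ ^ (-γ : ℂ) * 𝓕 u ξ)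

theorem ae_ne_zero_real : ∀ᵐ ξ : ℝ, ξ ≠ 0 := by
  simp [ae_iff]

/-- The transform of the (n+1)-st difference of g is known both from `H` and from the top
derivative. The common factor (1 - e^(-2πiξh))^(n+1) cancels for a suitable h depending on ξ. -/
theorem HasFractionalIntegralDifferences.fourier_iteratedDeriv {γ : ℝ} {u g : ℝ → ℂ}
    (H : HasFractionalIntegralDifferences γ u g) {n : ℕ}
    (hg : ∀ k < n + 1, Differentiable ℝ (iteratedDeriv k g))
    (hG : Integrable (iteratedDeriv (n + 1) g)) {ξ : ℝ} (hξ : ξ ≠ 0) :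
    𝓕 (iteratedDeriv (n + 1) g) ξ =
      derivSymbol ξ ^ (n + 1) * (derivSymbol ξ ^ (-γ : ℂ) * 𝓕 u ξ) := by
  -- Half a period of the character at ξ: the exponential is -1, so the factor to cancel is 2^(n+1).
  set h : ℝ := 1 / (2 * |ξ|) with hh
  have hξ' : 0 < |ξ| := abs_pos.2 hξ
  have hpos : 0 < h := by positivity
  obtain ⟨h1, h2⟩ := H h hpos
  have h3 := (fourier_iterate_backwardDiff h1 h ξ n).2
  have h4 := (derivSymbol_pow_mul_fourier_iterate_backwardDiff hpos.le ξ (n + 1) hg hG).2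
  rw [Function.iterate_succ_apply, h3, h2 ξ hξ] at h4
  have he : Complex.exp (-(derivSymbol ξ * h)) = -1 := by
    rcases lt_or_gt_of_ne hξ with hneg | hp
    · have : -(derivSymbol ξ * h) = Real.pi * Complex.I := by
        have hξc : (ξ : ℂ) ≠ 0 := by exact_mod_cast hξ
        rw [hh, abs_of_neg hneg, derivSymbol]
        push_cast
        field_simp
      rw [this, Complex.exp_pi_mul_I]
    · have : -(derivSymbol ξ * h) = -(Real.pi * Complex.I) := by
        have hξc : (ξ : ℂ) ≠ 0 := by exact_mod_cast hξ
        rw [hh, abs_of_pos hp, derivSymbol]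
        push_cast
        field_simp
      rw [this, Complex.exp_neg, Complex.exp_pi_mul_I]
      norm_num
  rw [he] at h4
  have hc : (1 - -1 : ℂ) ^ (n + 1) ≠ 0 := pow_ne_zero _ (by norm_num)
  apply mul_left_cancel₀ hc
  rw [← h4]
  ring

theorem derivSymbol_cpow_add {ξ : ℝ} (hξ : ξ ≠ 0) (s t : ℝ) :
    derivSymbol ξ ^ ((s + t : ℝ) : ℂ) = derivSymbol ξ ^ (s : ℂ) * derivSymbol ξ ^ (t : ℂ) := by
  push_cast
  exact Complex.cpow_add _ _ (derivSymbol_ne_zero hξ)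

/-- On [-1, 1] the integrand is bounded; outside, |2πξ| ≥ 1 and the power σ dominates the power s.
-/
theorem integrable_derivSymbol_cpow_mul {f : ℝ → ℂ} (hf : Continuous f) {M : ℝ}
    (hM : ∀ ξ, ‖f ξ‖ ≤ M) {s σ : ℝ}
    (hσ : Integrable fun ξ => derivSymbol ξ ^ (σ : ℂ) * f ξ) (hs : 0 ≤ s) (hsσ : s ≤ σ) :
    Integrable fun ξ => derivSymbol ξ ^ (s : ℂ) * f ξ := by
  have hi : Integrable (indicator (Icc (-1) 1) fun _ : ℝ => (2 * Real.pi) ^ s * M) :=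
    (integrable_indicator_iff measurableSet_Icc).2 continuous_const.integrableOn_Icc
  refine (hi.add hσ.norm).mono'
    ((measurable_derivSymbol_cpow _).mul hf.measurable).aestronglyMeasurable
    (.of_forall fun ξ => ?_)
  have hM0 : 0 ≤ M := (norm_nonneg _).trans (hM 0)
  rw [Pi.add_apply, norm_mul, Complex.norm_cpow_real, norm_derivSymbol]
  by_cases hξ : ξ ∈ Icc (-1 : ℝ) 1
  · rw [indicator_of_mem hξ]
    have h1 : |2 * Real.pi * ξ| ≤ 2 * Real.pi := by
      rw [abs_mul, abs_of_pos Real.two_pi_pos]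
      exact mul_le_of_le_one_right Real.two_pi_pos.le (abs_le.2 hξ)
    have h2 : |2 * Real.pi * ξ| ^ s * ‖f ξ‖ ≤ (2 * Real.pi) ^ s * M :=
      mul_le_mul (Real.rpow_le_rpow (abs_nonneg _) h1 hs) (hM ξ) (norm_nonneg _)
        (by positivity)
    exact h2.trans (le_add_of_nonneg_right (norm_nonneg _))
  · rw [indicator_of_notMem hξ, zero_add, norm_mul, Complex.norm_cpow_real, norm_derivSymbol]
    have h1 : 1 < |ξ| := by
      by_contra hc
      exact hξ (abs_le.1 (not_lt.1 hc))
    have h2 : 1 ≤ |2 * Real.pi * ξ| := by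
      rw [abs_mul, abs_of_pos Real.two_pi_pos]
      nlinarith [Real.pi_gt_three]
    gcongr

/-- Fourier inversion for the difference itself; its transform is integrable since |1 - e^(-2πiξh)|
≤ h |2πξ|. -/
theorem HasFractionalIntegralDifferences.backwardDiff_eq {γ : ℝ} {u g : ℝ → ℂ}
    (H : HasFractionalIntegralDifferences γ u g) (hg : Continuous g)
    (hi : Integrable fun ξ => derivSymbol ξ ^ ((1 - γ : ℝ) : ℂ) * 𝓕 u ξ) {h : ℝ} (hh : 0 < h)
    (x : ℝ) : backwardDiff h g x = ∫ ξ : ℝ, Complex.exp (derivSymbol ξ * x) *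
      ((1 - Complex.exp (-(derivSymbol ξ * h))) / derivSymbol ξ *
        (derivSymbol ξ ^ ((1 - γ : ℝ) : ℂ) * 𝓕 u ξ)) := by
  obtain ⟨h1, h2⟩ := H h hh
  have hae : ∀ᵐ ξ : ℝ, 𝓕 (backwardDiff h g) ξ =
      (1 - Complex.exp (-(derivSymbol ξ * h))) / derivSymbol ξ *
        (derivSymbol ξ ^ ((1 - γ : ℝ) : ℂ) * 𝓕 u ξ) := by
    filter_upwards [ae_ne_zero_real] with ξ hξ
    have h0 := derivSymbol_ne_zero hξ
    rw [h2 ξ hξ, sub_eq_add_neg (1 : ℝ) γ, derivSymbol_cpow_add hξ, Complex.ofReal_one,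
      Complex.cpow_one, Complex.ofReal_neg]
    field_simp
  have hint : Integrable (𝓕 (backwardDiff h g)) := by
    refine (hi.norm.const_mul h).mono' (continuous_fourier h1).aestronglyMeasurable ?_
    filter_upwards [hae, ae_ne_zero_real] with ξ hξ hξ0
    have h0 : 0 < ‖derivSymbol ξ‖ := norm_pos_iff.2 (derivSymbol_ne_zero hξ0)
    rw [hξ, norm_mul, norm_div]
    gcongr
    rw [div_le_iff₀ h0, mul_comm h]
    simpa [abs_of_pos hh] using norm_one_sub_exp_neg_derivSymbol_le ξ h
  have hcont : Continuous (backwardDiff h g) := by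
    unfold backwardDiff; fun_prop
  rw [← congrFun (hcont.fourierInv_fourier_eq h1 hint) x, fourierInv_eq_integral_derivSymbol]
  refine integral_congr_ae ?_
  filter_upwards [hae] with ξ hξ
  rw [hξ]

/-- Divide the formula for the backward difference by h and let h → 0⁺ under dominated convergence.
As g is already differentiable, this one-sided limit is its derivative. -/
theorem HasFractionalIntegralDifferences.deriv_eq {γ : ℝ} {u g : ℝ → ℂ}
    (H : HasFractionalIntegralDifferences γ u g) (hg : Differentiable ℝ g)
    (hi : Integrable fun ξ => derivSymbol ξ ^ ((1 - γ : ℝ) : ℂ) * 𝓕 u ξ) :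
    deriv g = 𝓕⁻ fun ξ => derivSymbol ξ ^ ((1 - γ : ℝ) : ℂ) * 𝓕 u ξ := by
  ext x
  set f : ℝ → ℂ := fun ξ => derivSymbol ξ ^ ((1 - γ : ℝ) : ℂ) * 𝓕 u ξ with hf
  have hneg : Filter.Tendsto (fun h : ℝ => -h) (nhdsWithin 0 (Ioi 0)) (nhdsWithin 0 {0}ᶜ) := by
    apply tendsto_nhdsWithin_of_tendsto_nhds_of_eventually_within
    · exact (by simpa using (continuous_neg (G := ℝ)).tendsto 0 :
        Filter.Tendsto (fun h : ℝ => -h) (nhds 0) (nhds 0)).mono_left nhdsWithin_le_nhds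
    · filter_upwards [self_mem_nhdsWithin] with h hh
      simpa using (ne_of_gt hh)
  have h1 := (hasDerivAt_iff_tendsto_slope_zero.1 (hg x).hasDerivAt).comp hneg
  have h2 : Filter.Tendsto (fun h : ℝ => ∫ ξ : ℝ, Complex.exp (derivSymbol ξ * x) *
      ((h : ℂ)⁻¹ * ((1 - Complex.exp (-(derivSymbol ξ * h))) / derivSymbol ξ) * f ξ))
      (nhdsWithin 0 (Ioi 0)) (nhds (∫ ξ : ℝ, Complex.exp (derivSymbol ξ * x) * f ξ)) := by
    apply tendsto_integral_filter_of_dominated_convergence fun ξ => ‖f ξ‖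
    · refine .of_forall fun h => ?_
      have hds := continuous_derivSymbol.measurable
      exact AEStronglyMeasurable.mul (by fun_prop)
        (AEStronglyMeasurable.mul (Measurable.aestronglyMeasurable (by fun_prop))
          hi.aestronglyMeasurable)
    · filter_upwards [self_mem_nhdsWithin] with h hh
      filter_upwards [ae_ne_zero_real] with ξ hξ
      have hh' : (0 : ℝ) < h := hh
      have h0 : 0 < ‖derivSymbol ξ‖ := norm_pos_iff.2 (derivSymbol_ne_zero hξ)
      rw [norm_mul, norm_exp_derivSymbol_mul, one_mul, norm_mul, norm_mul, norm_div, norm_inv,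
        Complex.norm_real, Real.norm_eq_abs]
      refine mul_le_of_le_one_left (norm_nonneg _) ?_
      rw [inv_mul_le_one₀ (abs_pos.2 hh'.ne'), div_le_iff₀ h0, mul_comm |h|]
      exact norm_one_sub_exp_neg_derivSymbol_le ξ h
    · exact hi.norm
    · filter_upwards [ae_ne_zero_real] with ξ hξ
      apply Filter.Tendsto.const_mul
      have hd : HasDerivAt (fun h : ℝ => 1 - Complex.exp (-(derivSymbol ξ * h)))
          (derivSymbol ξ) 0 := by
        have h3 : HasDerivAt (fun h : ℝ => -(derivSymbol ξ * (h : ℂ))) (-(derivSymbol ξ)) 0 := by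
          simpa using (hasDerivAt_id (0 : ℝ)).ofReal_comp.const_mul (-derivSymbol ξ)
        simpa using h3.cexp.const_sub 1
      have h4 := (hasDerivAt_iff_tendsto_slope_zero.1 hd).mono_left
        (nhdsWithin_mono (0 : ℝ) (show Ioi (0 : ℝ) ⊆ {0}ᶜ from fun h hh => ne_of_gt hh))
      have h5 := (h4.div_const (derivSymbol ξ)).mul_const (f ξ)
      rw [div_self (derivSymbol_ne_zero hξ), one_mul] at h5
      refine h5.congr fun h => ?_
      simp only [zero_add, Complex.ofReal_zero, mul_zero, neg_zero, Complex.exp_zero, sub_self,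
        sub_zero, Complex.real_smul, Complex.ofReal_inv]
      ring
  rw [fourierInv_eq_integral_derivSymbol]
  refine tendsto_nhds_unique h1 (h2.congr' ?_)
  filter_upwards [self_mem_nhdsWithin] with h hh
  have hb := H.backwardDiff_eq hg.continuous hi hh x
  rw [backwardDiff] at hb
  have : ((-h)⁻¹ • (g (x + -h) - g x)) = (h : ℂ)⁻¹ * (g x - g (x - h)) := by
    rw [Complex.real_smul, ← sub_eq_add_neg]
    push_cast
    rw [inv_neg]
    ring
  rw [Function.comp_apply, this, hb, ← integral_const_mul]
  refine integral_congr_ae (.of_forall fun ξ => ?_)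
  simp only [hf]
  ring

theorem HasFractionalIntegralDifferences.iteratedDeriv_two_eq {γ : ℝ}
    {u g : ℝ → ℂ} (H : HasFractionalIntegralDifferences γ u g) (hg : Differentiable ℝ g)
    (hi : Integrable fun ξ => derivSymbol ξ ^ ((1 - γ : ℝ) : ℂ) * 𝓕 u ξ)
    (hi' : Integrable fun ξ => derivSymbol ξ ^ ((2 - γ : ℝ) : ℂ) * 𝓕 u ξ) :
    iteratedDeriv 2 g = 𝓕⁻ fun ξ => derivSymbol ξ ^ ((2 - γ : ℝ) : ℂ) * 𝓕 u ξ := by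
  have hae : (fun ξ => derivSymbol ξ ^ ((2 - γ : ℝ) : ℂ) * 𝓕 u ξ) =ᵐ[volume]
      fun ξ => derivSymbol ξ * (derivSymbol ξ ^ ((1 - γ : ℝ) : ℂ) * 𝓕 u ξ) := by
    filter_upwards [ae_ne_zero_real] with ξ hξ
    rw [show 2 - γ = 1 + (1 - γ) by ring, derivSymbol_cpow_add hξ, Complex.ofReal_one,
      Complex.cpow_one, mul_assoc]
  rw [iteratedDeriv_succ, iteratedDeriv_one, H.deriv_eq hg hi]
  ext x
  rw [(hasDerivAt_fourierInv hi (hi'.congr hae) x).deriv]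
  exact (Real.fourierInv_congr_ae hae x).symm

/-! ### The kernel of the fractional integral -/

theorem integrableOn_rpow_mul_cexp {s : ℝ} (hs : -1 < s) {r : ℂ} (hr : 0 < r.re) :
    IntegrableOn (fun t : ℝ => ((t ^ s : ℝ) : ℂ) * Complex.exp (-(r * t))) (Ioi 0) := by
  have h := integrableOn_rpow_mul_exp_neg_mul_rpow hs one_pos hr
  simp only [Real.rpow_one] at h
  refine h.mono' ?_ ?_
  · apply Measurable.aestronglyMeasurable
    fun_prop
  · filter_upwards [ae_restrict_mem measurableSet_Ioi] with t ht
    have ht' : (0 : ℝ) < t := ht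
    rw [norm_mul, Complex.norm_real, Real.norm_of_nonneg (by positivity), Complex.norm_exp]
    simp

/-- The Laplace transform of `t ^ (γ - 1)` on the right half plane. -/
theorem integral_rpow_mul_cexp_neg_mul {γ : ℝ} (hγ : 0 < γ) {r : ℂ} (hr : 0 < r.re) :
    ∫ t in Ioi (0 : ℝ), ((t ^ (γ - 1) : ℝ) : ℂ) * Complex.exp (-(r * t)) =
      Real.Gamma γ * r ^ (-γ : ℂ) := by
  set U : Set ℂ := {z | 0 < z.re} with hU
  have hUo : IsOpen U := isOpen_lt continuous_const Complex.continuous_re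
  have hUc : IsPreconnected U := (convex_halfSpace_re_gt 0).isPreconnected
  have hF : AnalyticOnNhd ℂ (fun r : ℂ => ∫ t in Ioi (0 : ℝ),
      ((t ^ (γ - 1) : ℝ) : ℂ) * Complex.exp (-(r * t))) U := by
    apply DifferentiableOn.analyticOnNhd _ hUo
    intro z hz
    have hz' : 0 < z.re := hz
    -- On this ball the y-derivative of the integrand is dominated by t^γ e^(-(Re z)t/2).
    have hball : ∀ y ∈ Metric.ball z (z.re / 2), z.re / 2 < y.re := by
      intro y hy
      have h1 := (Complex.abs_re_le_norm (y - z)).trans_lt (mem_ball_iff_norm.1 hy)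
      rw [Complex.sub_re, abs_lt] at h1
      linarith
    have hb := integrableOn_rpow_mul_exp_neg_mul_rpow (s := γ) (p := 1) (b := z.re / 2)
      (by linarith) one_pos (by linarith)
    simp only [Real.rpow_one] at hb
    refine ((hasDerivAt_integral_of_dominated_loc_of_deriv_le
      (μ := volume.restrict (Ioi 0))
      (F := fun y t => ((t ^ (γ - 1) : ℝ) : ℂ) * Complex.exp (-(y * t)))
      (F' := fun y t => ((t ^ (γ - 1) : ℝ) : ℂ) * (Complex.exp (-(y * t)) * (-(t : ℂ))))
      (Metric.ball_mem_nhds z (half_pos hz')) (.of_forall fun y => ?_)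
      (integrableOn_rpow_mul_cexp (by linarith) hz')
      ?_ ?_ hb ?_).2).differentiableAt.differentiableWithinAt
    · exact Measurable.aestronglyMeasurable (by fun_prop)
    · exact Measurable.aestronglyMeasurable (by fun_prop)
    · filter_upwards [ae_restrict_mem measurableSet_Ioi] with t ht y hy
      have ht' : (0 : ℝ) < t := ht
      rw [norm_mul, norm_mul, norm_neg, Complex.norm_real, Complex.norm_real,
        Real.norm_of_nonneg ht'.le, Real.norm_of_nonneg (by positivity), Complex.norm_exp]
      have e : t ^ γ = t ^ (γ - 1) * t := by
        rw [← Real.rpow_add_one ht'.ne']; simp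
      have h2 : (-(y * (t : ℂ))).re ≤ -(z.re / 2) * t := by
        simp only [Complex.neg_re, Complex.mul_re, Complex.ofReal_re, Complex.ofReal_im, mul_zero,
          sub_zero]
        nlinarith [hball y hy]
      calc t ^ (γ - 1) * (Real.exp (-(y * (t : ℂ))).re * t)
          = t ^ γ * Real.exp (-(y * (t : ℂ))).re := by rw [e]; ring
        _ ≤ _ := by gcongr
    · refine .of_forall fun t y _ => ?_
      apply HasDerivAt.const_mul
      have h3 : HasDerivAt (fun y : ℂ => -(y * t)) (-(t : ℂ)) y := by
        simpa using ((hasDerivAt_id y).mul_const (t : ℂ)).fun_neg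
      exact h3.cexp
  have hG : AnalyticOnNhd ℂ (fun r : ℂ => (Real.Gamma γ : ℂ) * r ^ (-γ : ℂ)) U := by
    intro z hz
    exact analyticAt_const.mul (analyticAt_id.cpow analyticAt_const (Or.inl hz))
  have hreal : ∀ x : ℝ, 0 < x → (∫ t in Ioi (0 : ℝ),
      ((t ^ (γ - 1) : ℝ) : ℂ) * Complex.exp (-((x : ℂ) * t))) =
        (Real.Gamma γ : ℂ) * (x : ℂ) ^ (-γ : ℂ) := by
    intro x hx
    have h1 := Real.integral_rpow_mul_exp_neg_mul_Ioi hγ hx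
    rw [one_div, Real.inv_rpow hx.le, ← Real.rpow_neg hx.le, mul_comm] at h1
    rw [← Complex.ofReal_neg, ← Complex.ofReal_cpow hx.le, ← Complex.ofReal_mul, ← h1]
    refine Eq.trans ?_ integral_complex_ofReal
    refine integral_congr_ae (.of_forall fun t => ?_)
    simp
  -- Identity theorem: both sides are analytic on the half plane and agree at reals decreasing to 1.
  have hfreq : ∃ᶠ z in nhdsWithin (1 : ℂ) {1}ᶜ, (∫ t in Ioi (0 : ℝ),
      ((t ^ (γ - 1) : ℝ) : ℂ) * Complex.exp (-(z * t))) =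
        (Real.Gamma γ : ℂ) * z ^ (-γ : ℂ) := by
    have ht : Filter.Tendsto (fun x : ℝ => (x : ℂ)) (nhdsWithin 1 (Ioi 1))
        (nhdsWithin (1 : ℂ) {1}ᶜ) := by
      apply tendsto_nhdsWithin_of_tendsto_nhds_of_eventually_within
      · have := Complex.continuous_ofReal.tendsto 1
        rw [Complex.ofReal_one] at this
        exact this.mono_left nhdsWithin_le_nhds
      · filter_upwards [self_mem_nhdsWithin] with x hx
        have : x ≠ 1 := ne_of_gt hx
        simpa using this
    refine ht.frequently (Filter.Eventually.frequently ?_)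
    filter_upwards [self_mem_nhdsWithin] with x hx
    exact hreal x (lt_trans one_pos hx)
  exact hF.eqOn_of_preconnected_of_frequently_eq hG hUc (z₀ := 1) (by simp [hU]) hfreq hr

/-- The kernel `t₊ ^ (γ - 1)`. -/
noncomputable def rlKernel (γ t : ℝ) : ℝ := indicator (Ioi 0) (fun t => t ^ (γ - 1)) t

theorem integrable_rlKernel_mul_cexp {γ : ℝ} (hγ : 0 < γ) {r : ℂ} (hr : 0 < r.re) :
    Integrable (fun t : ℝ => (rlKernel γ t : ℂ) * Complex.exp (-(r * t))) := by
  refine ((integrable_indicator_iff measurableSet_Ioi).2 (integrableOn_rpow_mul_cexp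
    (s := γ - 1) (by linarith) hr)).congr (.of_forall fun t => ?_)
  by_cases ht : t ∈ Ioi (0 : ℝ) <;> simp [rlKernel, ht]

theorem integral_rlKernel_mul_cexp {γ : ℝ} (hγ : 0 < γ) {r : ℂ} (hr : 0 < r.re) :
    ∫ t : ℝ, (rlKernel γ t : ℂ) * Complex.exp (-(r * t)) = Real.Gamma γ * r ^ (-γ : ℂ) := by
  rw [← integral_rpow_mul_cexp_neg_mul hγ hr, ← integral_indicator measurableSet_Ioi]
  refine integral_congr_ae (.of_forall fun t => ?_)
  by_cases ht : t ∈ Ioi (0 : ℝ) <;> simp [rlKernel, ht]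

/-- The kernel alone is not integrable at infinity. Up to h only the integrable singularity at 0
matters; beyond h the difference has constant sign and an explicit primitive with a limit at
infinity. -/
theorem integrable_rlKernel_sub {γ : ℝ} (h0 : 0 < γ) (h1 : γ < 1) {h : ℝ} (hh : 0 < h) :
    Integrable fun t => rlKernel γ t - rlKernel γ (t - h) := by
  have hleft : IntegrableOn (fun t => rlKernel γ t - rlKernel γ (t - h)) (Iic h) := by
    have hi : IntegrableOn (fun t : ℝ => t ^ (γ - 1)) (Ioc 0 h) :=
      (intervalIntegrable_iff_integrableOn_Ioc_of_le hh.le).1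
        (intervalIntegral.intervalIntegrable_rpow' (by linarith))
    rw [← integrable_indicator_iff measurableSet_Iic]
    refine ((integrable_indicator_iff measurableSet_Ioc).2 hi).congr (.of_forall fun t => ?_)
    rcases le_or_gt t h with ht | ht
    · by_cases ht0 : 0 < t <;> simp [rlKernel, indicator, ht, ht0, ht.not_gt]
    · simp [indicator, ht.not_ge]
  have hright : IntegrableOn (fun t => rlKernel γ t - rlKernel γ (t - h)) (Ioi h) := by
    have hi : IntegrableOn (fun t : ℝ => (t - h) ^ (γ - 1) - t ^ (γ - 1)) (Ioi h) := by
      refine integrableOn_Ioi_deriv_of_nonneg (g := fun t => ((t - h) ^ γ - t ^ γ) / γ) (l := 0)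
        ?_ ?_ ?_ ?_
      · apply Continuous.continuousWithinAt
        exact ((Real.continuous_rpow_const h0.le).comp (continuous_sub_right h)).sub
          (Real.continuous_rpow_const h0.le) |>.div_const γ
      · intro t ht
        have ht' : h < t := ht
        have d1 := ((hasDerivAt_id t).sub_const h).rpow_const (p := γ)
          (Or.inl (by simp; linarith))
        have d2 := (hasDerivAt_id t).rpow_const (p := γ) (Or.inl (by simp; linarith))
        refine ((d1.sub d2).div_const γ).congr_deriv ?_
        simp only [id]
        field_simp
      · intro t ht
        have ht' : h < t := ht
        have := Real.rpow_le_rpow_of_nonpos (x := t - h) (y := t) (z := γ - 1) (by linarith)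
          (by linarith) (by linarith)
        linarith
      · have hlim : Filter.Tendsto (fun t : ℝ => h * (t - h) ^ (γ - 1)) Filter.atTop (nhds 0) := by
          have e1 := (tendsto_rpow_neg_atTop (y := 1 - γ) (by linarith)).comp
            (Filter.tendsto_atTop_add_const_right Filter.atTop (-h) Filter.tendsto_id)
          have e2 := e1.const_mul h
          rw [mul_zero] at e2
          refine e2.congr fun t => ?_
          simp [sub_eq_add_neg]
        apply squeeze_zero_norm' _ hlim
        filter_upwards [Filter.eventually_gt_atTop h] with t ht
        have hth : 0 < t - h := by linarith
        -- Bernoulli's inequality gives t^γ - (t - h)^γ ≤ γ h (t - h)^(γ-1), which tends to 0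
        -- because γ < 1.
        have b := rpow_one_add_le_one_add_mul_self (s := h / (t - h)) (p := γ)
          (by have : 0 < h / (t - h) := by positivity
              linarith) h0.le h1.le
        have e : t ^ γ = (t - h) ^ γ * (1 + h / (t - h)) ^ γ := by
          rw [← Real.mul_rpow hth.le (by positivity)]
          congr 1
          field_simp
          ring
        have e' : (t - h) ^ γ = (t - h) ^ (γ - 1) * (t - h) := by
          rw [← Real.rpow_add_one hth.ne']; simp
        have up : t ^ γ ≤ (t - h) ^ γ + γ * (h * (t - h) ^ (γ - 1)) := by
          rw [e]
          refine (mul_le_mul_of_nonneg_left b (by positivity)).trans_eq ?_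
          rw [e']
          field_simp
        have lo : (t - h) ^ γ ≤ t ^ γ := Real.rpow_le_rpow hth.le (by linarith) h0.le
        rw [Real.norm_eq_abs, abs_div, abs_of_pos h0, abs_of_nonpos (by linarith),
          div_le_iff₀ h0]
        linarith
    rw [← integrable_indicator_iff measurableSet_Ioi] at hi ⊢
    refine hi.neg.congr (.of_forall fun t => ?_)
    by_cases ht : h < t
    · have ht0 : 0 < t := hh.trans ht
      simp [rlKernel, indicator, ht, ht0]
    · simp [ht]
  have := hleft.union hright
  rwa [Iic_union_Ioi, integrableOn_univ] at this

/-- Damping by e^(-εt) makes the two kernels separately integrable, so the Laplace transform at ε +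
2πiξ applies. As ε → 0⁺ the left side converges since the difference is integrable and lives on t >
0; ξ ≠ 0 keeps the power off its branch cut. -/
theorem fourier_rlKernel_sub {γ : ℝ} (h0 : 0 < γ) (h1 : γ < 1) {h : ℝ} (hh : 0 < h)
    {ξ : ℝ} (hξ : ξ ≠ 0) :
    𝓕 (fun t => ((rlKernel γ t - rlKernel γ (t - h) : ℝ) : ℂ)) ξ =
      (1 - Complex.exp (-(derivSymbol ξ * h))) *
        (Real.Gamma γ * derivSymbol ξ ^ (-γ : ℂ)) := by
  set κ : ℝ → ℂ := fun t => ((rlKernel γ t - rlKernel γ (t - h) : ℝ) : ℂ) with hκ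
  have hκi : Integrable κ := (integrable_rlKernel_sub h0 h1 hh).ofReal
  have hκ0 : ∀ t ≤ 0, κ t = 0 := by
    intro t ht
    have h2 : ¬ h < t := by linarith
    simp [hκ, rlKernel, indicator, ht, h2]
  have hpos : ∀ ε : ℝ, 0 < ε → 0 < ((ε : ℂ) + derivSymbol ξ).re := by
    intro ε hε
    simpa [derivSymbol] using hε
  have hreg : ∀ ε : ℝ, 0 < ε → ∫ t : ℝ, κ t * Complex.exp (-((ε + derivSymbol ξ) * t)) =
      (1 - Complex.exp (-((ε + derivSymbol ξ) * h))) *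
        (Real.Gamma γ * ((ε : ℂ) + derivSymbol ξ) ^ (-γ : ℂ)) := by
    intro ε hε
    set r : ℂ := ε + derivSymbol ξ
    have hi := integrable_rlKernel_mul_cexp h0 (hpos ε hε)
    have hi' := (hi.comp_sub_right h).const_mul (Complex.exp (-(r * h)))
    rw [← integral_rlKernel_mul_cexp h0 (hpos ε hε), sub_mul, one_mul, ← integral_const_mul,
      ← integral_sub_right_eq_self (fun t : ℝ => Complex.exp (-(r * h)) *
        ((rlKernel γ t : ℂ) * Complex.exp (-(r * t)))) h, ← integral_sub hi hi']
    refine integral_congr_ae (.of_forall fun t => ?_)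
    have e : Complex.exp (-(r * t)) =
        Complex.exp (-(r * h)) * Complex.exp (-(r * ((t - h : ℝ) : ℂ))) := by
      rw [← Complex.exp_add]; congr 1; push_cast; ring
    simp only [hκ]
    push_cast at e ⊢
    linear_combination (-(rlKernel γ (t - h) : ℂ)) * e
  have hL : Filter.Tendsto (fun ε : ℝ => ∫ t : ℝ, κ t * Complex.exp (-((ε + derivSymbol ξ) * t)))
      (nhdsWithin 0 (Ioi 0)) (nhds (∫ t : ℝ, κ t * Complex.exp (-(derivSymbol ξ * t)))) := by
    apply tendsto_integral_filter_of_dominated_convergence fun t => ‖κ t‖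
    · refine .of_forall fun ε => hκi.aestronglyMeasurable.mul ?_
      exact Continuous.aestronglyMeasurable (by fun_prop)
    · filter_upwards [self_mem_nhdsWithin] with ε hε
      refine .of_forall fun t => ?_
      have hε' : (0 : ℝ) < ε := hε
      rcases le_or_gt t 0 with ht | ht
      · simp [hκ0 t ht]
      · rw [norm_mul]
        refine mul_le_of_le_one_right (norm_nonneg _) ?_
        rw [Complex.norm_exp, Real.exp_le_one_iff]
        simp [derivSymbol]
        positivity
    · exact hκi.norm
    · refine .of_forall fun t => Filter.Tendsto.const_mul _ ?_
      have hc : Continuous fun ε : ℝ => Complex.exp (-((ε + derivSymbol ξ) * t)) := by fun_prop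
      simpa using (hc.tendsto 0).mono_left nhdsWithin_le_nhds
  have hR : Filter.Tendsto (fun ε : ℝ => (1 - Complex.exp (-((ε + derivSymbol ξ) * h))) *
        (Real.Gamma γ * ((ε : ℂ) + derivSymbol ξ) ^ (-γ : ℂ)))
      (nhdsWithin 0 (Ioi 0)) (nhds ((1 - Complex.exp (-(derivSymbol ξ * h))) *
        (Real.Gamma γ * derivSymbol ξ ^ (-γ : ℂ)))) := by
    have hslit : derivSymbol ξ ∈ Complex.slitPlane :=
      Or.inr (by simp [derivSymbol, Real.pi_ne_zero, hξ])
    have hc : ContinuousAt (fun z : ℂ => (1 - Complex.exp (-(z * h))) *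
        (Real.Gamma γ * z ^ (-γ : ℂ))) (derivSymbol ξ) := by
      have : ContinuousAt (fun z : ℂ => z ^ (-γ : ℂ)) (derivSymbol ξ) :=
        continuousAt_cpow_const hslit
      fun_prop
    have hp : Filter.Tendsto (fun ε : ℝ => (ε : ℂ) + derivSymbol ξ) (nhdsWithin 0 (Ioi 0))
        (nhds (derivSymbol ξ)) := by
      have hc : Continuous fun ε : ℝ => (ε : ℂ) + derivSymbol ξ := by fun_prop
      simpa using (hc.tendsto 0).mono_left nhdsWithin_le_nhds
    exact hc.tendsto.comp hp
  rw [fourier_eq_integral_derivSymbol]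
  simp only [mul_comm (Complex.exp _)]
  refine tendsto_nhds_unique hL (hR.congr' ?_)
  filter_upwards [self_mem_nhdsWithin] with ε hε
  exact (hreg ε hε).symm

theorem leftRLIntegral_eq_integral_rlKernel {γ : ℝ} (h0 : 0 < γ) (u : ℝ → ℂ) (x : ℝ) :
    leftRLIntegral γ u x = (1 / Real.Gamma γ) • ∫ s, (rlKernel γ (x - s) : ℂ) * u s := by
  rw [leftRLIntegral, if_neg h0.ne', ← integral_indicator measurableSet_Iio]
  congr 2
  ext s
  by_cases hs : s < x <;> simp [rlKernel, indicator, hs]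

/-- The difference is 1/Γ(γ) times u convolved with the integrable kernel difference. The case γ =
0, that is α = 2, is separate: there the fractional integral is u itself. -/
theorem hasFractionalIntegralDifferences_leftRLIntegral {γ : ℝ} (h0 : 0 ≤ γ) (h1 : γ < 1)
    {u : ℝ → ℂ} (hu : Integrable u)
    (hconv : γ ≠ 0 → ∀ x : ℝ, IntegrableOn (fun s : ℝ => ((x - s) ^ (γ - 1)) • u s) (Iio x)) :
    HasFractionalIntegralDifferences γ u (leftRLIntegral γ u) := by
  intro h hh
  rcases eq_or_lt_of_le h0 with rfl | hpos
  · have e : leftRLIntegral 0 u = u := by ext x; simp [leftRLIntegral]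
    rw [e]
    refine ⟨hu.backwardDiff h, fun ξ hξ => ?_⟩
    rw [fourier_backwardDiff hu]
    simp
  have hi : ∀ x, Integrable fun s => (rlKernel γ (x - s) : ℂ) * u s := by
    intro x
    refine ((integrable_indicator_iff measurableSet_Iio).2 (hconv hpos.ne' x)).congr
      (.of_forall fun s => ?_)
    by_cases hs : s < x <;> simp [rlKernel, indicator, hs]
  set κ : ℝ → ℂ := fun t => ((rlKernel γ t - rlKernel γ (t - h) : ℝ) : ℂ) with hκ
  have hκi : Integrable κ := (integrable_rlKernel_sub hpos h1 hh).ofReal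
  have hG : (Real.Gamma γ : ℂ) ≠ 0 := by exact_mod_cast (Real.Gamma_pos_of_pos hpos).ne'
  have e : backwardDiff h (leftRLIntegral γ u) = fun x =>
      (1 / (Real.Gamma γ : ℂ)) * (convolution u κ (ContinuousLinearMap.mul ℂ ℂ) volume) x := by
    ext x
    rw [backwardDiff, leftRLIntegral_eq_integral_rlKernel hpos,
      leftRLIntegral_eq_integral_rlKernel hpos, ← smul_sub, ← integral_sub (hi x) (hi (x - h)),
      Complex.real_smul]
    push_cast
    congr 1
    refine integral_congr_ae (.of_forall fun s => ?_)
    simp only [hκ, ContinuousLinearMap.mul_apply']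
    rw [show x - h - s = x - s - h by ring]
    push_cast
    ring
  rw [e]
  refine ⟨(hu.integrable_convolution _ hκi).const_mul _, fun ξ hξ => ?_⟩
  have h2 := Real.fourier_mul_convolution_eq hu hκi ξ
  rw [fourier_rlKernel_sub hpos h1 hh hξ, fourier_eq_integral_derivSymbol] at h2
  rw [fourier_eq_integral_derivSymbol]
  have h3 : ∀ a : ℝ → ℂ, ∫ x : ℝ, Complex.exp (-(derivSymbol ξ * x)) *
      ((1 / (Real.Gamma γ : ℂ)) * a x) =
      (1 / (Real.Gamma γ : ℂ)) * ∫ x : ℝ, Complex.exp (-(derivSymbol ξ * x)) * a x := by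
    intro a
    rw [← integral_const_mul]
    refine integral_congr_ae (.of_forall fun x => ?_)
    simp only
    ring
  rw [h3, h2]
  field_simp

/-! ### Grünwald differences of inverse Fourier integrals -/

/-- Absolute summability of the weights allows summation under the integral; the binomial series is
then used on the unit circle, at e^(-2πiξh). -/
theorem hasSum_grunwaldWeight_smul_fourierInv {α : ℝ} (h1 : 1 ≤ α) (h2 : α ≤ 2) {f : ℝ → ℂ}
    (hf : Integrable f) (h p x : ℝ) :
    HasSum (fun k : ℕ => grunwaldWeight α k • 𝓕⁻ f (x - ((k : ℝ) - p) * h))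
      (∫ ξ : ℝ, Complex.exp (derivSymbol ξ * x) * (Complex.exp (p * (derivSymbol ξ * h)) *
        (1 - Complex.exp (-(derivSymbol ξ * h))) ^ (α : ℂ) * f ξ)) := by
  set F : ℕ → ℝ → ℂ := fun k ξ => (grunwaldWeight α k : ℂ) *
    (Complex.exp (derivSymbol ξ * ((x - ((k : ℝ) - p) * h : ℝ) : ℂ)) * f ξ) with hF
  have hFi : ∀ k, Integrable (F k) := fun k =>
    (integrable_exp_derivSymbol_mul hf _).const_mul _
  have hFn : ∀ k ξ, ‖F k ξ‖ = |grunwaldWeight α k| * ‖f ξ‖ := by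
    intro k ξ
    rw [hF, norm_mul, norm_mul, norm_exp_derivSymbol_mul, one_mul, Complex.norm_real,
      Real.norm_eq_abs]
  have hs : Summable fun k => ∫ ξ, ‖F k ξ‖ := by
    simp only [hFn, integral_const_mul]
    exact (summable_abs_grunwaldWeight h1 h2).mul_right _
  have key := hasSum_integral_of_summable_integral_norm hFi hs
  have e1 : ∀ k, ∫ ξ, F k ξ = grunwaldWeight α k • 𝓕⁻ f (x - ((k : ℝ) - p) * h) := by
    intro k
    rw [fourierInv_eq_integral_derivSymbol, Complex.real_smul, ← integral_const_mul]
  have e2 : ∀ ξ, ∑' k, F k ξ = Complex.exp (derivSymbol ξ * x) *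
      (Complex.exp (p * (derivSymbol ξ * h)) *
        (1 - Complex.exp (-(derivSymbol ξ * h))) ^ (α : ℂ) * f ξ) := by
    intro ξ
    have hz : ‖Complex.exp (-(derivSymbol ξ * h))‖ ≤ 1 := by
      have := norm_exp_derivSymbol_mul ξ (-h)
      push_cast at this
      rw [mul_neg] at this
      exact this.le
    have hb := (hasSum_grunwaldWeight h1 h2 hz).mul_left
      (Complex.exp (derivSymbol ξ * x) * Complex.exp (p * (derivSymbol ξ * h)) * f ξ)
    rw [show Complex.exp (derivSymbol ξ * x) * (Complex.exp (p * (derivSymbol ξ * h)) *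
        (1 - Complex.exp (-(derivSymbol ξ * h))) ^ (α : ℂ) * f ξ) =
      Complex.exp (derivSymbol ξ * x) * Complex.exp (p * (derivSymbol ξ * h)) * f ξ *
        (1 - Complex.exp (-(derivSymbol ξ * h))) ^ (α : ℂ) by ring, ← hb.tsum_eq]
    refine tsum_congr fun k => ?_
    have : Complex.exp (derivSymbol ξ * ((x - ((k : ℝ) - p) * h : ℝ) : ℂ)) =
        Complex.exp (derivSymbol ξ * x) * Complex.exp (p * (derivSymbol ξ * h)) *
          Complex.exp (-(derivSymbol ξ * h)) ^ k := by
      rw [← Complex.exp_nat_mul, ← Complex.exp_add, ← Complex.exp_add]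
      congr 1
      push_cast
      ring
    simp only [hF, this]
    ring
  simp only [e1, e2] at key
  exact key

theorem integrable_grunwald_symbol_mul {α : ℝ} (hα : 0 ≤ α) {f : ℝ → ℂ} (hf : Integrable f)
    (h p : ℝ) : Integrable fun ξ => Complex.exp (p * (derivSymbol ξ * h)) *
      (1 - Complex.exp (-(derivSymbol ξ * h))) ^ (α : ℂ) * f ξ := by
  have hds := continuous_derivSymbol.measurable
  apply hf.bdd_mul (c := 2 ^ α)
  · exact Measurable.aestronglyMeasurable (by fun_prop)
  · refine .of_forall fun ξ => ?_
    have e1 := norm_exp_derivSymbol_mul ξ (p * h)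
    have e2 := norm_exp_derivSymbol_mul ξ (-h)
    push_cast at e1 e2
    rw [mul_neg] at e2
    rw [norm_mul, Complex.norm_cpow_real, show (p : ℂ) * (derivSymbol ξ * h) =
      derivSymbol ξ * (p * h) by ring, e1, one_mul]
    refine Real.rpow_le_rpow (norm_nonneg _) ((norm_sub_le _ _).trans ?_) hα
    rw [e2]
    norm_num

/-- If the Fourier transform of a function is integrable against `|ξ| ^ (α + 2)`, the weighted
shifted Grünwald difference is a second order approximation of the fractional derivative. -/
theorem norm_leftWSGD_fourierInv_sub_le {α : ℝ} (h1 : 1 ≤ α) (h2 : α ≤ 2) {m : ℕ}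
    {lam p : Fin m → ℝ} {C : ℝ}
    (hC : ∀ y : ℝ, ‖∑ j, (lam j : ℂ) * (Complex.exp (p j * (y * Complex.I)) *
      (1 - Complex.exp (-(y * Complex.I))) ^ (α : ℂ)) - (y * Complex.I) ^ (α : ℂ)‖
        ≤ C * |y| ^ (α + 2)) {f : ℝ → ℂ} (hf : Integrable f)
    (hfα : Integrable fun ξ => derivSymbol ξ ^ (α : ℂ) * f ξ)
    (hf2 : Integrable fun ξ => derivSymbol ξ ^ ((α + 2 : ℝ) : ℂ) * f ξ)
    {h : ℝ} (hh : 0 < h) (x : ℝ) :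
    ‖leftWSGD α h lam p (𝓕⁻ f) x - 𝓕⁻ (fun ξ => derivSymbol ξ ^ (α : ℂ) * f ξ) x‖ ≤
      C * (∫ ξ, ‖derivSymbol ξ ^ ((α + 2 : ℝ) : ℂ) * f ξ‖) * h ^ 2 := by
  set S : Fin m → ℝ → ℂ := fun j ξ => Complex.exp (p j * (derivSymbol ξ * h)) *
    (1 - Complex.exp (-(derivSymbol ξ * h))) ^ (α : ℂ) with hS
  have hSi : ∀ j, Integrable fun ξ => S j ξ * f ξ := fun j =>
    integrable_grunwald_symbol_mul (by linarith) hf h (p j)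
  have hsum : Integrable fun ξ => ∑ j, (lam j : ℂ) * (S j ξ * f ξ) :=
    integrable_finsetSum _ fun j _ => (hSi j).const_mul _
  set E : ℝ → ℂ := fun ξ => (1 / h ^ α : ℝ) * (∑ j, (lam j : ℂ) * (S j ξ * f ξ)) -
    derivSymbol ξ ^ (α : ℂ) * f ξ with hE
  have e1 : leftWSGD α h lam p (𝓕⁻ f) x = ∫ ξ : ℝ, Complex.exp (derivSymbol ξ * x) *
      ((1 / h ^ α : ℝ) * (∑ j, (lam j : ℂ) * (S j ξ * f ξ))) := by
    have : ∀ j, lam j • leftGrunwald α h (p j) (𝓕⁻ f) x =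
        ∫ ξ : ℝ, (lam j : ℂ) * ((1 / h ^ α : ℝ) *
          (Complex.exp (derivSymbol ξ * x) * (S j ξ * f ξ))) := by
      intro j
      rw [leftGrunwald, (hasSum_grunwaldWeight_smul_fourierInv h1 h2 hf h (p j) x).tsum_eq,
        integral_const_mul, integral_const_mul, Complex.real_smul, Complex.real_smul]
    rw [leftWSGD, Finset.sum_congr rfl fun j _ => this j, ← integral_finsetSum]
    · refine integral_congr_ae (.of_forall fun ξ => ?_)
      simp only [Finset.mul_sum]
      exact Finset.sum_congr rfl fun j _ => by ring
    · exact fun j _ => ((integrable_exp_derivSymbol_mul (hSi j) x).const_mul _).const_mul _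
  have e2 : leftWSGD α h lam p (𝓕⁻ f) x - 𝓕⁻ (fun ξ => derivSymbol ξ ^ (α : ℂ) * f ξ) x =
      𝓕⁻ E x := by
    rw [e1, fourierInv_eq_integral_derivSymbol, fourierInv_eq_integral_derivSymbol, ← integral_sub
      (integrable_exp_derivSymbol_mul (hsum.const_mul _) x)
      (integrable_exp_derivSymbol_mul hfα x)]
    simp only [hE, mul_sub]
  rw [e2]
  refine (norm_fourierInv_le E x).trans ?_
  rw [mul_right_comm, ← integral_const_mul]
  refine integral_mono_ae ((hsum.const_mul _).sub hfα).norm (hf2.norm.const_mul _) ?_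
  filter_upwards [ae_ne_zero_real] with ξ hξ
  have hhα : 0 < h ^ α := Real.rpow_pos_of_pos hh α
  have hz : derivSymbol ξ * h = ((2 * Real.pi * ξ * h : ℝ) : ℂ) * Complex.I := by
    rw [derivSymbol]; push_cast; ring
  -- Homogeneity of the power lets the symbol bound be used at y = 2πξh; then h^(-α) · h^(α+2)
  -- leaves h².
  have hpow : (derivSymbol ξ * h) ^ (α : ℂ) = derivSymbol ξ ^ (α : ℂ) * ((h ^ α : ℝ) : ℂ) := by
    rw [Complex.mul_cpow_of_re_pos (derivSymbol_ne_zero hξ) (by simp [derivSymbol]) (by simpa),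
      Complex.ofReal_cpow hh.le]
  have e3 : E ξ = (1 / h ^ α : ℝ) * (∑ j, (lam j : ℂ) * S j ξ - (derivSymbol ξ * h) ^ (α : ℂ)) *
      f ξ := by
    have hne : ((h ^ α : ℝ) : ℂ) ≠ 0 := by exact_mod_cast hhα.ne'
    rw [hE, hpow]
    simp only [← mul_assoc, ← Finset.sum_mul]
    push_cast at hne ⊢
    field_simp
  have hb := hC (2 * Real.pi * ξ * h)
  rw [← hz] at hb
  have hab : |2 * Real.pi * ξ * h| ^ (α + 2) = ‖derivSymbol ξ‖ ^ (α + 2) * (h ^ α * h ^ 2) := by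
    rw [abs_mul, abs_of_pos hh, Real.mul_rpow (abs_nonneg _) hh.le, norm_derivSymbol,
      Real.rpow_add hh]
    norm_cast
  rw [hab] at hb
  simp only [e3, norm_mul, Complex.norm_real, Complex.norm_cpow_real, Real.norm_eq_abs]
  rw [abs_of_pos (one_div_pos.2 hhα)]
  calc _ ≤ 1 / h ^ α * (C * (‖derivSymbol ξ‖ ^ (α + 2) * (h ^ α * h ^ 2))) * ‖f ξ‖ := by gcongr
    _ = _ := by field_simp

/-! ### Transfer to `u` and conclusion -/

theorem leftWSGD_congr {m : ℕ} {α h x : ℝ} {lam p : Fin m → ℝ} {u v : ℝ → ℂ}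
    (huv : ∀ (j : Fin m) (k : ℕ), u (x - ((k : ℝ) - p j) * h) = v (x - ((k : ℝ) - p j) * h)) :
    leftWSGD α h lam p u x = leftWSGD α h lam p v x := by
  simp only [leftWSGD, leftGrunwald, huv]

theorem theorem1 (α : ℝ) (hα₁ : 1 < α) (hα₂ : α ≤ 2)
    (u : ℝ → ℂ) (hu : Integrable u)
    (hD : LeftRLDifferentiable (α + 2) u)
    (hDint : Integrable (leftRLDeriv (α + 2) u))
    (hDfourier : Integrable (𝓕 (leftRLDeriv (α + 2) u)))
    (m : ℕ) (hm : 2 ≤ m) (lam p : Fin m → ℝ)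
    (hlam : ∑ j, lam j = 1)
    (hlamp : ∑ j, lam j * (p j - α / 2) = 0) :
    LeftRLDifferentiable α u ∧
    ∃ C h₀ : ℝ, 0 < h₀ ∧ ∀ h : ℝ, 0 < h → h < h₀ →
      (∀ᵐ x : ℝ,
        (∀ j, Summable fun k : ℕ => grunwaldWeight α k • u (x - ((k : ℝ) - p j) * h)) ∧
        ‖leftWSGD α h lam p u x - leftRLDeriv α u x‖ ≤ C * h ^ 2) ∧
      (Continuous u → ∀ x : ℝ,
        (∀ j, Summable fun k : ℕ => grunwaldWeight α k • u (x - ((k : ℝ) - p j) * h)) ∧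
        ‖leftWSGD α h lam p u x - leftRLDeriv α u x‖ ≤ C * h ^ 2) := by
  have hc2 : ⌈α⌉₊ = 2 := by
    rw [Nat.ceil_eq_iff (by norm_num)]; norm_num; exact ⟨hα₁, hα₂⟩
  have hc4 : ⌈α + 2⌉₊ = 4 := by
    rw [Nat.ceil_eq_iff (by norm_num)]; norm_num; constructor <;> linarith
  have hγ2 : ((2 : ℕ) : ℝ) - α = 2 - α := by norm_num
  have hγ4 : ((4 : ℕ) : ℝ) - (α + 2) = 2 - α := by push_cast; ring
  simp only [LeftRLDifferentiable, leftRLDeriv, hc2, hc4, hγ2, hγ4] at *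
  obtain ⟨hconv, hdiff⟩ := hD
  refine ⟨⟨hconv, fun k hk => hdiff k (by omega)⟩, ?_⟩
  set g := leftRLIntegral (2 - α) u
  have H : HasFractionalIntegralDifferences (2 - α) u g :=
    hasFractionalIntegralDifferences_leftRLIntegral (by linarith) (by linarith) hu
      fun h => hconv h
  have hf2 : Integrable fun ξ => derivSymbol ξ ^ ((α + 2 : ℝ) : ℂ) * 𝓕 u ξ := by
    refine hDfourier.congr ?_
    filter_upwards [ae_ne_zero_real] with ξ hξ
    rw [H.fourier_iteratedDeriv (n := 3) hdiff hDint hξ,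
      show α + 2 = ((4 : ℕ) : ℝ) + -(2 - α) by push_cast; ring, derivSymbol_cpow_add hξ, mul_assoc,
      Complex.ofReal_natCast, Complex.cpow_natCast, Complex.ofReal_neg]
  have hfs : ∀ s, 0 ≤ s → s ≤ α + 2 →
      Integrable fun ξ => derivSymbol ξ ^ (s : ℂ) * 𝓕 u ξ := fun s hs hs' =>
    integrable_derivSymbol_cpow_mul (continuous_fourier hu)
      (VectorFourier.norm_fourierIntegral_le_integral_norm _ _ _ _) hf2 hs hs'
  have hf : Integrable (𝓕 u) := by simpa using hfs 0 le_rfl (by linarith)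
  have hderiv := H.iteratedDeriv_two_eq (by simpa using hdiff 0 (by norm_num))
    (hfs _ (by linarith) (by linarith)) (hfs _ (by linarith) (by linarith))
  rw [sub_sub_cancel] at hderiv
  obtain ⟨C, -, hC⟩ := exists_symbol_bound (by linarith : 0 < α) lam p hlam hlamp
  refine ⟨C * ∫ ξ, ‖derivSymbol ξ ^ ((α + 2 : ℝ) : ℂ) * 𝓕 u ξ‖, 1, one_pos, fun h hh _ => ?_⟩
  have main : ∀ x : ℝ, (∀ (j : Fin m) (k : ℕ), 𝓕⁻ (𝓕 u) (x - ((k : ℝ) - p j) * h) =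
      u (x - ((k : ℝ) - p j) * h)) →
      (∀ j, Summable fun k : ℕ => grunwaldWeight α k • u (x - ((k : ℝ) - p j) * h)) ∧
        ‖leftWSGD α h lam p u x - iteratedDeriv 2 g x‖ ≤
          (C * ∫ ξ, ‖derivSymbol ξ ^ ((α + 2 : ℝ) : ℂ) * 𝓕 u ξ‖) * h ^ 2 := by
    intro x hx
    constructor
    · intro j
      simpa only [hx j] using
        (hasSum_grunwaldWeight_smul_fourierInv hα₁.le hα₂ hf h (p j) x).summable
    · rw [← leftWSGD_congr hx, hderiv]
      exact norm_leftWSGD_fourierInv_sub_le hα₁.le hα₂ hC hf (hfs α (by linarith) (by linarith))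
        hf2 hh x
  constructor
  · have hae : ∀ᵐ x : ℝ, ∀ (j : Fin m) (k : ℕ), 𝓕⁻ (𝓕 u) (x - ((k : ℝ) - p j) * h) =
        u (x - ((k : ℝ) - p j) * h) := by
      rw [ae_all_iff]
      intro j
      rw [ae_all_iff]
      intro k
      exact (measurePreserving_sub_right volume _).quasiMeasurePreserving.ae
        (hu.fourierInv_fourier_ae_eq hf)
    filter_upwards [hae] with x hx using main x hx
  · intro hcont x
    exact main x fun j k => congrFun (hcont.fourierInv_fourier_eq hu hf) _
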